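/- Let $\nu>0$, $\mu\ge 0$ with $\nu+\mu=1$. For $1\le C_N\le N$ let $(X_N(t))_{t\ge0}$ be the Engset process: the right-continuous Markov jump process on $\{0,1,\dots,C_N\}$ that jumps from $x$ to $x-1$ at rate $\mu x$, and from $x$ to $x+1$ at rate $\nu(N-x)$ if $x<C_N$. Let $$T_{C_N}=\inf\{s\ge 0: X_N(s)=C_N\}.$$ Assume that $0<\eta<\nu$, that $C_N=\eta N+O(1)$ as $N\to\infty$, and that $X_N(0)=0$ almost surely. Then $T_{C_N}<\infty$ almost surely for every $N\ge 1$, and, as $N\to\infty$, the random variables $$\sqrt N\left(T_{C_N}-\log\frac{\nu}{\nu-\eta}\right)$$ converge in distribution to a centered normal random variable with variance $\dfrac{\eta(1-\eta)}{(\nu-\eta)^2}$. -/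

import Mathlib

open MeasureTheory ProbabilityTheory Filter
open scoped Topology NNReal

noncomputable section

/-- `X` is, under `P`, a (continuous-time, time-homogeneous) Markov jump process on the finite
state space `S` with `Q`-matrix `Q`: its paths are almost surely right-continuous for the discrete
topology of `S`, and it has the Markov property with respect to its own past, with transition
probabilities `p_t(x, y) = (exp (t Q))(x, y)`, that is
`P(A, X_s = x, X_t = y) = P(A, X_s = x) p_{t - s}(x, y)` for all `s ≤ t` and all events `A` of the
`σ`-algebra generated by `(X_r, r ≤ s)`. -/
structure IsMarkovJumpProcess {Ω S : Type*} [MeasurableSpace Ω] [Fintype S] [DecidableEq S]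
    [MeasurableSpace S] [DiscreteMeasurableSpace S]
    (Q : Matrix S S ℝ) (X : ℝ≥0 → Ω → S) (P : Measure Ω) : Prop where
  measurable : ∀ t, Measurable (X t)
  rightContinuous : ∀ᵐ ω ∂P, ∀ t : ℝ≥0, ∀ᶠ s in 𝓝[≥] t, X s ω = X t ω
  markov : ∀ s t : ℝ≥0, s ≤ t → ∀ A : Set Ω,
    MeasurableSet[⨆ r ≤ s, MeasurableSpace.comap (X r) inferInstance] A → ∀ x y : S,
      P.real (A ∩ {ω | X s ω = x} ∩ {ω | X t ω = y}) =
        P.real (A ∩ {ω | X s ω = x}) * (NormedSpace.exp (((t : ℝ) - (s : ℝ)) • Q)) x y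

/-- The `Q`-matrix of the Engset process with `N` sources and `C` circuits, on the state space
`{0, …, C}`: from `x` to `x - 1` at rate `μ x`, and from `x` to `x + 1` at rate `ν (N - x)`
if `x < C`; all other off-diagonal entries vanish and the rows sum to `0`. -/
def engsetQ (ν μ : ℝ) (N C : ℕ) : Matrix (Fin (C + 1)) (Fin (C + 1)) ℝ :=
  Matrix.of fun x y =>
    if (y : ℕ) + 1 = x then μ * (x : ℕ)
    else if (y : ℕ) = x + 1 then ν * ((N : ℝ) - (x : ℕ))
    else if y = x then
      -(μ * (x : ℕ) + if (x : ℕ) < C then ν * ((N : ℝ) - (x : ℕ)) else 0)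
    else 0

/-- `X` is an Engset process with `N` sources, `C` circuits and rates `ν`, `μ`. -/
def IsEngsetProcess {Ω : Type*} [MeasurableSpace Ω] (ν μ : ℝ) (N C : ℕ)
    (X : ℝ≥0 → Ω → Fin (C + 1)) (P : Measure Ω) : Prop :=
  IsMarkovJumpProcess (engsetQ ν μ N C) X P

/-- The time `inf {s ≥ 0 : X_s = C}` at which the state `C` is hit, with value `⊤` if this
never happens. -/
def blockingTime {Ω : Type*} {C : ℕ} (X : ℝ≥0 → Ω → Fin (C + 1)) : Ω → WithTop ℝ≥0 :=
  hittingAfter X {Fin.last C} 0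

end

/-! The process counts the busy sources among `N` independent on-off sources, up to blocking. For
one source, the function equal to `μ` when busy and `-ν` when idle is an eigenfunction of the
generator with eigenvalue `-(ν + μ) = -1`. Multiplying over sources, `(1 + u μ e^s)^x (1 - u ν
e^s)^(N - x)` solves the backward equation below `C`, and Dynkin's formula at `τ = T ∧ (t₀ + 1)`,
where `e^t₀ (ν - η) = ν`, gives it the mean `(1 - u ν)^N`
(`IsEngsetProcess.integral_exponential_cappedHit`).

Take `u = iθ/√N`. At `T` the state is known to be `C ≈ ηN`, so the martingale is a function of `T`
alone: up to a small error it is `exp(-iθν√N (T - t₀))` times an explicit constant. Comparing with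
the expansion of `(1 - u ν)^N` yields the limiting characteristic function.

The error is quadratic in `T - t₀`. It is controlled by `Y = e^s (x - νN) + νN`, whose second moment
at `τ` is `O(N)` (`IsEngsetProcess.integral_sq_cappedHit_le`). If `T ≤ t₀ + 1`, then `√N (T - t₀)²`
is bounded through `Y² / N^(3/2)`; if `T` is later, `|Y|` is of order `N` and the same quantity
absorbs a trivial bound (`exists_norm_exponential_sub_le`). The characteristic functions thus differ
by `O(1/√N)`.

Dynkin's formula is derived from the Markov property by discretising time. Almost sure finiteness of
`T` comes from the same formula, applied to the mean hitting time function. -/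

/-! ### Transition probabilities as matrix exponentials. -/

section MatrixExp

open scoped Matrix.Norms.Operator

variable {S : Type*} [Fintype S] [DecidableEq S]

/-- The entries of the transition matrices are differentiable in time. -/
theorem hasDerivAt_exp_smul_apply (Q : Matrix S S ℝ) (x y : S) (r : ℝ) :
    HasDerivAt (fun r : ℝ => NormedSpace.exp (r • Q) x y) ((NormedSpace.exp (r • Q) * Q) x y) r :=
  ((hasDerivAt_pi.1 ((hasDerivAt_pi.1 (hasDerivAt_exp_smul_const (𝕂 := ℝ) Q r)) x)) y)

theorem continuous_exp_smul_apply (Q : Matrix S S ℝ) (x y : S) :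
    Continuous (fun r : ℝ => NormedSpace.exp (r • Q) x y) :=
  continuous_iff_continuousAt.2 fun r => (hasDerivAt_exp_smul_apply Q x y r).continuousAt

theorem exp_zero_smul_apply (Q : Matrix S S ℝ) (x y : S) :
    NormedSpace.exp ((0 : ℝ) • Q) x y = if x = y then 1 else 0 := by
  rw [zero_smul, NormedSpace.exp_zero, Matrix.one_apply]

end MatrixExp

/-! ### One-step estimates from the backward equation. -/

section Generator

variable {S : Type*} [Fintype S] [DecidableEq S] {E : Type*} [NormedAddCommGroup E]
  [NormedSpace ℝ E]

/-- Off-diagonal transition probabilities are `O(r)`. -/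
theorem exists_abs_exp_smul_apply_le (Q : Matrix S S ℝ) (t : ℝ) {x y : S} (hxy : x ≠ y) :
    ∃ K, 0 ≤ K ∧ ∀ r ∈ Set.Icc 0 t, |NormedSpace.exp (r • Q) x y| ≤ K * r := by
  have hcont : Continuous fun r : ℝ => (NormedSpace.exp (r • Q) * Q) x y := by
    simp only [Matrix.mul_apply]
    exact continuous_finsetSum _ fun z _ => (continuous_exp_smul_apply Q x z).mul continuous_const
  obtain ⟨K, hK⟩ := (isCompact_Icc (a := (0 : ℝ)) (b := t)).exists_bound_of_continuousOn
    hcont.continuousOn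
  refine ⟨max K 0, le_max_right _ _, fun r hr => ?_⟩
  have h := norm_image_sub_le_of_norm_deriv_le_segment' (a := (0 : ℝ)) (b := t) (C := max K 0)
    (fun u _ => (hasDerivAt_exp_smul_apply Q x y u).hasDerivWithinAt)
    (fun u hu => (hK u ⟨hu.1, hu.2.le⟩).trans (le_max_left _ _)) r hr
  simpa [exp_zero_smul_apply, hxy] using h

/-- One step of a function solving the backward equation off the state `c` has a drift of second
order in the step size, uniformly on bounded time intervals. -/
theorem exists_norm_step_le (Q : Matrix S S ℝ) (c : S) {F F' : ℝ → S → E}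
    (hF : ∀ s y, HasDerivAt (fun s => F s y) (F' s y) s) (hF' : ∀ y, Continuous fun s => F' s y)
    (hQ : ∀ s, ∀ x, x ≠ c → F' s x + ∑ y, Q x y • F s y = 0) (t : ℝ) :
    ∃ K, 0 ≤ K ∧ ∀ s h, 0 ≤ s → 0 ≤ h → s + h ≤ t → ∀ x, x ≠ c →
      ‖∑ y, NormedSpace.exp (h • Q) x y • F (s + h) y - F s x‖ ≤ K * h ^ 2 := by
  have hFc : ∀ y, Continuous fun s => F s y := fun y =>
    continuous_iff_continuousAt.2 fun s => (hF s y).continuousAt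
  have hΦ : Continuous fun u => ∑ y, Q c y • F u y + F' u c :=
    (continuous_finsetSum _ fun y _ => (hFc y).const_smul _).add (hF' c)
  obtain ⟨K₂, hK₂⟩ := (isCompact_Icc (a := (0 : ℝ)) (b := t)).exists_bound_of_continuousOn
    hΦ.continuousOn
  choose! K₁ hK₁0 hK₁ using fun (x : S) (hx : x ≠ c) => exists_abs_exp_smul_apply_le Q t hx
  refine ⟨∑ x ∈ Finset.univ.erase c, K₁ x * max K₂ 0, Finset.sum_nonneg fun x hx =>
    mul_nonneg (hK₁0 x (Finset.ne_of_mem_erase hx)) (le_max_right _ _),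
    fun s h hs hh hst x hx => ?_⟩
  -- Differentiating produces the defect of the backward equation averaged over the state at time
  -- `r`, and only the state `c` contributes. Its weight is `O(r)` because `x ≠ c`, which makes the
  -- integrated drift `O(h²)`.
  have hder : ∀ r : ℝ, HasDerivAt (fun r => ∑ y, NormedSpace.exp (r • Q) x y • F (s + r) y)
      (NormedSpace.exp (r • Q) x c • (∑ y, Q c y • F (s + r) y + F' (s + r) c)) r := by
    intro r
    have h1 := HasDerivAt.fun_sum (u := Finset.univ) fun y _ =>
      (hasDerivAt_exp_smul_apply Q x y r).smul ((hF (s + r) y).comp_const_add s r)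
    convert! h1 using 1
    have h2 : ∑ z, NormedSpace.exp (r • Q) x z • (∑ y, Q z y • F (s + r) y + F' (s + r) z)
        = NormedSpace.exp (r • Q) x c • (∑ y, Q c y • F (s + r) y + F' (s + r) c) := by
      refine Finset.sum_eq_single c (fun z _ hz => ?_) (by simp)
      rw [add_comm, hQ _ z hz, smul_zero]
    rw [← h2]
    simp only [smul_add, Finset.sum_add_distrib, Matrix.mul_apply, Finset.sum_smul,
      Finset.smul_sum, smul_smul]
    rw [Finset.sum_comm, add_comm]
  have hb := norm_image_sub_le_of_norm_deriv_le_segment' (a := (0 : ℝ)) (b := h)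
    (C := K₁ x * h * max K₂ 0)
    (fun u _ => (hder u).hasDerivWithinAt) (fun u hu => by
      rw [norm_smul]
      refine mul_le_mul ((hK₁ x hx u ⟨hu.1, by linarith [hu.2]⟩).trans
        (mul_le_mul_of_nonneg_left hu.2.le (hK₁0 x hx)))
        ((hK₂ _ ⟨by linarith [hu.1], by linarith [hu.2]⟩).trans (le_max_left _ _))
        (norm_nonneg _) (mul_nonneg (hK₁0 x hx) hh)) h ⟨hh, le_rfl⟩
  have h0 : ∑ y, NormedSpace.exp ((0 : ℝ) • Q) x y • F (s + 0) y = F s x := by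
    simp [Matrix.one_apply]
  rw [h0] at hb
  refine hb.trans ?_
  have hsingle : K₁ x * max K₂ 0 ≤ ∑ x ∈ Finset.univ.erase c, K₁ x * max K₂ 0 :=
    Finset.single_le_sum (f := fun x => K₁ x * max K₂ 0) (fun y hy =>
      mul_nonneg (hK₁0 y (Finset.ne_of_mem_erase hy)) (le_max_right _ _))
      (Finset.mem_erase.2 ⟨hx, Finset.mem_univ _⟩)
  calc K₁ x * h * max K₂ 0 * (h - 0) = K₁ x * max K₂ 0 * h ^ 2 := by ring
    _ ≤ _ := mul_le_mul_of_nonneg_right hsingle (sq_nonneg h)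

end Generator

/-! ### Hitting times of right-continuous paths. -/

section Paths

variable {Ω S : Type*} {X : ℝ≥0 → Ω → S} {c : S} {ω : Ω}

/-- A right-continuous path is in the target state at its hitting time. -/
theorem apply_eq_of_hittingAfter_eq (hright : ∀ t : ℝ≥0, ∀ᶠ s in 𝓝[≥] t, X s ω = X t ω)
    {u : ℝ≥0} (hu : hittingAfter X {c} 0 ω = u) : X u ω = c := by
  by_contra hne
  have hex : ∃ j, 0 ≤ j ∧ X j ω ∈ ({c} : Set S) := by
    by_contra hno
    rw [hittingAfter_def] at hu
    simp only [hno, if_false] at hu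
    exact WithTop.coe_ne_top hu.symm
  rw [hittingAfter_def] at hu
  simp only [hex, if_true] at hu
  have hu' : sInf (Set.Ici 0 ∩ {i | X i ω ∈ ({c} : Set S)}) = u := WithTop.coe_injective hu
  obtain ⟨v, hv, hsub⟩ := mem_nhdsGE_iff_exists_Ico_subset.1 (hright u)
  obtain ⟨s, hs, hsv⟩ := exists_lt_of_csInf_lt
    (s := Set.Ici 0 ∩ {i | X i ω ∈ ({c} : Set S)}) (b := v)
    (by obtain ⟨j, hj⟩ := hex; exact ⟨j, hj⟩) (by rw [hu']; exact hv)
  have hus : u ≤ s := by rw [← hu']; exact csInf_le (OrderBot.bddBelow _) hs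
  have h1 : X s ω = X u ω := hsub ⟨hus, hsv⟩
  exact hne (h1.symm.trans hs.2)

theorem apply_ne_of_lt_hittingAfter {s : ℝ≥0} (hs : (s : WithTop ℝ≥0) < hittingAfter X {c} 0 ω) :
    X s ω ≠ c := notMem_of_lt_hittingAfter hs bot_le

/-- The hitting time of `c`, capped at `t`. -/
noncomputable def cappedHit (X : ℝ≥0 → Ω → S) (c : S) (t : ℝ≥0) (ω : Ω) : ℝ≥0 :=
  (min (hittingAfter X {c} 0 ω) (t : WithTop ℝ≥0)).untopD 0

theorem cappedHit_of_lt {t u : ℝ≥0} (hu : hittingAfter X {c} 0 ω = u) (hut : u ≤ t) :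
    cappedHit X c t ω = u := by
  rw [cappedHit, hu, min_eq_left (WithTop.coe_le_coe.2 hut), WithTop.untopD_coe]

theorem cappedHit_of_le {t : ℝ≥0} (h : (t : WithTop ℝ≥0) ≤ hittingAfter X {c} 0 ω) :
    cappedHit X c t ω = t := by
  rw [cappedHit, min_eq_right h, WithTop.untopD_coe]

theorem cappedHit_le (X : ℝ≥0 → Ω → S) (c : S) (t : ℝ≥0) (ω : Ω) : cappedHit X c t ω ≤ t := by
  rcases le_or_gt (t : WithTop ℝ≥0) (hittingAfter X {c} 0 ω) with h | h
  · exact (cappedHit_of_le h).le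
  · obtain ⟨u, hu⟩ := WithTop.ne_top_iff_exists.1 h.ne_top
    rw [← hu] at h
    rw [cappedHit_of_lt hu.symm (WithTop.coe_lt_coe.1 h).le]
    exact (WithTop.coe_lt_coe.1 h).le

end Paths

/-! ### Stopping along a time grid. -/

section Grid

variable {Ω S : Type*} {E : Type*} [NormedAddCommGroup E]

/-- The value of `F (s, X s)` along the grid of mesh `h`, stopped at the first visit to `c` on the
grid or after `n` steps. -/
noncomputable def gridStopped (F : ℝ → S → E) (X : ℝ≥0 → Ω → S) (c : S) (h : ℝ≥0) (n : ℕ)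
    (ω : Ω) : E :=
  F 0 (X 0 ω) + ∑ k ∈ Finset.range n,
    {ω | ∀ j ≤ k, X (j * h) ω ≠ c}.indicator
      (fun ω => F ((k + 1 : ℕ) * h : ℝ≥0) (X ((k + 1 : ℕ) * h) ω)
        - F ((k : ℝ≥0) * h : ℝ≥0) (X (k * h) ω)) ω

/-- Here `m` is the first visit to `c` on the grid, or `n` if there is none before: the increments
from `m` on are switched off, and the earlier ones telescope. -/
theorem gridStopped_eq {F : ℝ → S → E} {X : ℝ≥0 → Ω → S} {c : S} {h : ℝ≥0} {n m : ℕ} {ω : Ω}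
    (hmn : m ≤ n) (hlt : ∀ j < m, X (j * h) ω ≠ c) (hm : m = n ∨ X (m * h) ω = c) :
    gridStopped F X c h n ω = F ((m : ℝ≥0) * h : ℝ≥0) (X (m * h) ω) := by
  have hsum : ∑ k ∈ Finset.range n, {ω | ∀ j ≤ k, X (j * h) ω ≠ c}.indicator
      (fun ω => F ((k + 1 : ℕ) * h : ℝ≥0) (X ((k + 1 : ℕ) * h) ω)
        - F ((k : ℝ≥0) * h : ℝ≥0) (X (k * h) ω)) ω
      = ∑ k ∈ Finset.range m, (F ((k + 1 : ℕ) * h : ℝ≥0) (X ((k + 1 : ℕ) * h) ω)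
        - F ((k : ℝ≥0) * h : ℝ≥0) (X (k * h) ω)) := by
    rw [← Finset.sum_subset (Finset.range_mono hmn)]
    · refine Finset.sum_congr rfl fun k hk => ?_
      rw [Set.indicator_of_mem]
      exact fun j hj => hlt j (lt_of_le_of_lt hj (Finset.mem_range.1 hk))
    · intro k hk hkm
      rw [Set.indicator_of_notMem]
      intro hall
      rcases hm with rfl | hm
      · exact hkm hk
      · exact hall m (by simpa using hkm) hm
  rw [gridStopped, hsum,
    Finset.sum_range_sub (fun k : ℕ => F ((k : ℝ≥0) * h : ℝ≥0) (X (k * h) ω))]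
  simp

/-- There is always a grid point at which the stopped grid process is evaluated. -/
theorem exists_gridStopped_eq (F : ℝ → S → E) (X : ℝ≥0 → Ω → S) (c : S) (h : ℝ≥0) (n : ℕ)
    (ω : Ω) : ∃ m ≤ n, gridStopped F X c h n ω = F ((m : ℝ≥0) * h : ℝ≥0) (X (m * h) ω) := by
  by_cases hex : ∃ m, m ≤ n ∧ X (m * h) ω = c
  · classical
    refine ⟨Nat.find hex, (Nat.find_spec hex).1, gridStopped_eq (Nat.find_spec hex).1
      (fun j hj hjc => Nat.find_min hex hj ⟨hj.le.trans (Nat.find_spec hex).1, hjc⟩)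
      (Or.inr (Nat.find_spec hex).2)⟩
  · push Not at hex
    exact ⟨n, le_rfl, gridStopped_eq le_rfl (fun j hj => hex j hj.le) (Or.inl rfl)⟩

/-- As the mesh tends to `0`, the stopped grid process converges to the value at the capped
hitting time. -/
theorem tendsto_gridStopped {F : ℝ → S → E} {X : ℝ≥0 → Ω → S} {c : S} {ω : Ω}
    (hF : ∀ y, Continuous fun s => F s y)
    (hright : ∀ t : ℝ≥0, ∀ᶠ s in 𝓝[≥] t, X s ω = X t ω) {t : ℝ≥0} (ht : 0 < t) :
    Tendsto (fun n : ℕ => gridStopped F X c (t / (n + 1 : ℕ)) (n + 1) ω) atTop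
      (𝓝 (F (cappedHit X c t ω) (X (cappedHit X c t ω) ω))) := by
  rcases le_or_gt (t : WithTop ℝ≥0) (hittingAfter X {c} 0 ω) with hle | hlt
  · refine tendsto_const_nhds.congr fun n => ?_
    rw [cappedHit_of_le hle]
    have hn : ((n + 1 : ℕ) : ℝ≥0) * (t / (n + 1 : ℕ)) = t :=
      mul_div_cancel₀ t (by positivity)
    rw [gridStopped_eq le_rfl _ (Or.inl rfl), hn]
    intro j hj
    refine apply_ne_of_lt_hittingAfter (lt_of_lt_of_le (WithTop.coe_lt_coe.2 ?_) hle)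
    calc (j : ℝ≥0) * (t / (n + 1 : ℕ)) < ((n + 1 : ℕ) : ℝ≥0) * (t / (n + 1 : ℕ)) := by
          gcongr
      _ = t := hn
  · obtain ⟨u, hu⟩ := WithTop.ne_top_iff_exists.1 hlt.ne_top
    rw [← hu] at hlt
    have hut : u < t := WithTop.coe_lt_coe.1 hlt
    have hXu : X u ω = c := apply_eq_of_hittingAfter_eq hright hu.symm
    rw [cappedHit_of_lt hu.symm hut.le, hXu]
    set h : ℕ → ℝ≥0 := fun n => t / (n + 1 : ℕ) with hh
    have hpos : ∀ n, 0 < h n := fun n => by positivity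
    -- The first grid point at or after `u`. It tends to `u` from the right, where the path still
    -- equals `c` by right-continuity; all earlier grid points precede the hitting time.
    set m : ℕ → ℕ := fun n => ⌈u / h n⌉₊ with hm
    have hge : ∀ n, u ≤ m n * h n := fun n =>
      (div_le_iff₀ (hpos n)).1 (Nat.le_ceil _)
    have hle : ∀ n, m n * h n ≤ u + h n := fun n => by
      have h1 : (m n : ℝ≥0) ≤ u / h n + 1 := (Nat.ceil_lt_add_one (zero_le)).le
      calc m n * h n ≤ (u / h n + 1) * h n := by gcongr
        _ = u + h n := by rw [add_mul, div_mul_cancel₀ _ (hpos n).ne', one_mul]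
    have hmn : ∀ n, m n ≤ n + 1 := fun n => by
      refine Nat.ceil_le.2 ((div_le_iff₀ (hpos n)).2 ?_)
      rw [hh, mul_div_cancel₀ t (by positivity)]
      exact hut.le
    have hh0 : Tendsto h atTop (𝓝 0) := by
      refine NNReal.tendsto_coe.1 ?_
      have h1 := (tendsto_const_div_atTop_nhds_zero_nat (t : ℝ)).comp (tendsto_add_atTop_nat 1)
      exact h1.congr fun n => by simp [hh]
    have hlim : Tendsto (fun n => (m n : ℝ≥0) * h n) atTop (𝓝 u) :=
      tendsto_of_tendsto_of_tendsto_of_le_of_le tendsto_const_nhds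
        (by simpa using hh0.const_add u) hge hle
    have hev : ∀ᶠ n in atTop, X (m n * h n) ω = c := by
      have := (tendsto_nhdsWithin_iff.2 ⟨hlim, Eventually.of_forall hge⟩).eventually (hright u)
      simpa only [hXu] using this
    have hlim' : Tendsto (fun n => F ((m n : ℝ≥0) * h n : ℝ≥0) c) atTop (𝓝 (F u c)) :=
      ((hF c).tendsto _).comp ((NNReal.continuous_coe.tendsto u).comp hlim)
    refine hlim'.congr' ?_
    filter_upwards [hev] with n hn
    rw [gridStopped_eq (hmn n) _ (Or.inr hn), hn]
    intro j hj
    refine apply_ne_of_lt_hittingAfter ?_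
    rw [← hu]
    exact WithTop.coe_lt_coe.2 ((lt_div_iff₀ (hpos n)).1 (Nat.lt_ceil.1 hj))

end Grid

/-! ### Dynkin's formula at the capped hitting time. -/

section Dynkin

variable {Ω S : Type*} [MeasurableSpace Ω] [Fintype S] [DecidableEq S] [MeasurableSpace S]
  [DiscreteMeasurableSpace S] {E : Type*} [NormedAddCommGroup E] [NormedSpace ℝ E]
  {Q : Matrix S S ℝ} {X : ℝ≥0 → Ω → S} {P : Measure Ω}

theorem IsMarkovJumpProcess.measurableSet_eq (hX : IsMarkovJumpProcess Q X P) (t : ℝ≥0) (x : S) :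
    MeasurableSet {ω | X t ω = x} := hX.measurable t (measurableSet_singleton x)

omit [NormedSpace ℝ E] in
theorem IsMarkovJumpProcess.stronglyMeasurable_comp (hX : IsMarkovJumpProcess Q X P) (t : ℝ≥0)
    (f : S → E) : StronglyMeasurable fun ω => f (X t ω) :=
  (StronglyMeasurable.of_discrete (f := f)).comp_measurable (hX.measurable t)

omit [MeasurableSpace Ω] [DecidableEq S] in
/-- The event of no visit to `c` at the first grid points belongs to the past. -/
theorem measurableSet_past_grid (X : ℝ≥0 → Ω → S) (c : S) (h : ℝ≥0) (k : ℕ) :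
    MeasurableSet[⨆ r ≤ (k * h : ℝ≥0), MeasurableSpace.comap (X r) inferInstance]
      {ω | ∀ j ≤ k, X (j * h) ω ≠ c} := by
  have heq : {ω | ∀ j ≤ k, X (j * h) ω ≠ c} =
      ⋂ j ∈ Finset.range (k + 1), (X (j * h)) ⁻¹' {c}ᶜ := by
    ext ω
    simp
  rw [heq]
  refine Finset.measurableSet_biInter _ fun j hj => ?_
  have hjk : (j * h : ℝ≥0) ≤ k * h := by
    gcongr
    exact Nat.lt_succ_iff.1 (Finset.mem_range.1 hj)
  exact (le_iSup₂_of_le (f := fun r (_ : r ≤ (k * h : ℝ≥0)) =>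
    MeasurableSpace.comap (X r) inferInstance) _ hjk le_rfl) _
    ⟨{c}ᶜ, (measurableSet_singleton c).compl, rfl⟩

theorem IsMarkovJumpProcess.past_le (hX : IsMarkovJumpProcess Q X P) (s : ℝ≥0) :
    (⨆ r ≤ s, MeasurableSpace.comap (X r) inferInstance) ≤ ‹MeasurableSpace Ω› :=
  iSup₂_le fun r _ => (hX.measurable r).comap_le

variable [IsProbabilityMeasure P]

/-- The Markov property for increments of functions of the state, restricted to an event of the
past. -/
theorem IsMarkovJumpProcess.integral_indicator_sub [CompleteSpace E] (hX : IsMarkovJumpProcess Q X P)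
    {s t : ℝ≥0} (hst : s ≤ t) {A : Set Ω}
    (hA : MeasurableSet[⨆ r ≤ s, MeasurableSpace.comap (X r) inferInstance] A) (f g : S → E) :
    ∫ ω, A.indicator (fun ω => f (X t ω) - g (X s ω)) ω ∂P =
      ∑ x, P.real (A ∩ {ω | X s ω = x}) •
        (∑ y, NormedSpace.exp (((t : ℝ) - (s : ℝ)) • Q) x y • f y - g x) := by
  have hA' : MeasurableSet A := hX.past_le s _ hA
  have hAx : ∀ x, MeasurableSet (A ∩ {ω | X s ω = x}) := fun x =>
    hA'.inter (hX.measurableSet_eq s x)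
  have hAxy : ∀ x y, MeasurableSet (A ∩ {ω | X s ω = x} ∩ {ω | X t ω = y}) := fun x y =>
    (hAx x).inter (hX.measurableSet_eq t y)
  have hpt : ∀ ω, A.indicator (fun ω => f (X t ω) - g (X s ω)) ω =
      ∑ x, ((∑ y, (A ∩ {ω | X s ω = x} ∩ {ω | X t ω = y}).indicator (fun _ => f y) ω)
        - (A ∩ {ω | X s ω = x}).indicator (fun _ => g x) ω) := by
    intro ω
    by_cases hω : ω ∈ A
    · rw [Finset.sum_sub_distrib, Finset.sum_eq_single (X s ω), Finset.sum_eq_single (X t ω),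
        Finset.sum_eq_single (X s ω)]
      · simp [hω]
      · intro x _ hx; simp [Ne.symm hx]
      · simp
      · intro x _ hx; simp [Ne.symm hx]
      · simp
      · intro x _ hx; simp [Ne.symm hx]
      · simp
    · simp [hω]
  have hint : ∀ {B : Set Ω}, MeasurableSet B → ∀ v : E, Integrable (B.indicator fun _ => v) P :=
    fun hB v => (integrable_const v).indicator hB
  simp_rw [hpt]
  have hi : ∀ x ∈ Finset.univ, Integrable (fun ω =>
      (∑ y, (A ∩ {ω | X s ω = x} ∩ {ω | X t ω = y}).indicator (fun _ => f y) ω)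
        - (A ∩ {ω | X s ω = x}).indicator (fun _ => g x) ω) P := fun x _ =>
    (integrable_finsetSum _ fun y _ => hint (hAxy x y) _).sub (hint (hAx x) _)
  rw [integral_finsetSum _ hi]
  refine Finset.sum_congr rfl fun x _ => ?_
  rw [integral_sub (integrable_finsetSum _ fun y _ => hint (hAxy x y) _) (hint (hAx x) _),
    integral_finsetSum _ fun y _ => hint (hAxy x y) _, integral_indicator_const _ (hAx x),
    smul_sub, Finset.smul_sum]
  congr 1
  refine Finset.sum_congr rfl fun y _ => ?_
  rw [integral_indicator_const _ (hAxy x y), hX.markov s t hst A hA x y, mul_smul]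

omit [NormedSpace ℝ E] in
theorem IsMarkovJumpProcess.integrable_indicator_sub (hX : IsMarkovJumpProcess Q X P)
    (s t : ℝ≥0) {A : Set Ω} (hA : MeasurableSet A) (f g : S → E) :
    Integrable (A.indicator fun ω => f (X t ω) - g (X s ω)) P := by
  have hf : ∀ (r : ℝ≥0) (f : S → E), Integrable (fun ω => f (X r ω)) P := fun r f =>
    Integrable.of_bound (hX.stronglyMeasurable_comp r f).aestronglyMeasurable
      (∑ y, ‖f y‖) (Eventually.of_forall fun ω =>
        Finset.single_le_sum (f := fun y => ‖f y‖) (fun _ _ => norm_nonneg _) (Finset.mem_univ _))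
  exact ((hf t f).sub (hf s g)).indicator hA

omit [DecidableEq S] [MeasurableSpace S] [DiscreteMeasurableSpace S] [NormedSpace ℝ E] in
/-- Values of a function continuous in time stay bounded on bounded time intervals. -/
theorem exists_norm_le_of_le {F : ℝ → S → E} (hF : ∀ y, Continuous fun s => F s y) (t : ℝ≥0) :
    ∃ K, ∀ s : ℝ≥0, s ≤ t → ∀ y, ‖F s y‖ ≤ K := by
  choose K hK using fun y => (isCompact_Icc (a := (0 : ℝ)) (b := t)).exists_bound_of_continuousOn
    (hF y).continuousOn
  refine ⟨∑ y, |K y|, fun s hs y => ((hK y s ⟨s.2, hs⟩).trans (le_abs_self _)).trans ?_⟩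
  exact Finset.single_le_sum (f := fun y => |K y|) (fun _ _ => abs_nonneg _) (Finset.mem_univ y)

omit [NormedSpace ℝ E] in
theorem IsMarkovJumpProcess.aestronglyMeasurable_gridStopped (hX : IsMarkovJumpProcess Q X P)
    (F : ℝ → S → E) (c : S) (h : ℝ≥0) (n : ℕ) :
    AEStronglyMeasurable (gridStopped F X c h n) P := by
  unfold gridStopped
  refine (hX.stronglyMeasurable_comp 0 (F 0)).aestronglyMeasurable.add ?_
  refine Finset.aestronglyMeasurable_fun_sum _ fun k _ => ?_
  exact (hX.integrable_indicator_sub _ _ (hX.past_le _ _ (measurableSet_past_grid X c h k))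
    _ _).aestronglyMeasurable

omit [NormedSpace ℝ E] in
theorem IsMarkovJumpProcess.aestronglyMeasurable_cappedHit (hX : IsMarkovJumpProcess Q X P)
    {F : ℝ → S → E} (hF : ∀ y, Continuous fun s => F s y) (c : S) {t : ℝ≥0} (ht : 0 < t) :
    AEStronglyMeasurable (fun ω => F (cappedHit X c t ω) (X (cappedHit X c t ω) ω)) P :=
  aestronglyMeasurable_of_tendsto_ae atTop
    (fun n : ℕ => hX.aestronglyMeasurable_gridStopped F c (t / (n + 1 : ℕ)) (n + 1))
    (by filter_upwards [hX.rightContinuous] with ω hω using tendsto_gridStopped hF hω ht)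

omit [NormedSpace ℝ E] in
theorem IsMarkovJumpProcess.integrable_cappedHit (hX : IsMarkovJumpProcess Q X P)
    {F : ℝ → S → E} (hF : ∀ y, Continuous fun s => F s y) (c : S) {t : ℝ≥0} (ht : 0 < t) :
    Integrable (fun ω => F (cappedHit X c t ω) (X (cappedHit X c t ω) ω)) P := by
  obtain ⟨K, hK⟩ := exists_norm_le_of_le hF t
  exact Integrable.of_bound (hX.aestronglyMeasurable_cappedHit hF c ht) K
    (Eventually.of_forall fun ω => hK _ (cappedHit_le X c t ω) _)

/-- Dynkin's formula at the capped hitting time, for a function solving the backward equation off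
the target state. -/
theorem IsMarkovJumpProcess.integral_cappedHit [CompleteSpace E] (hX : IsMarkovJumpProcess Q X P) {x₀ : S}
    (hX0 : ∀ᵐ ω ∂P, X 0 ω = x₀) (c : S) {F F' : ℝ → S → E}
    (hF : ∀ s y, HasDerivAt (fun s => F s y) (F' s y) s) (hF' : ∀ y, Continuous fun s => F' s y)
    (hQ : ∀ s, ∀ x, x ≠ c → F' s x + ∑ y, Q x y • F s y = 0) {t : ℝ≥0} (ht : 0 < t) :
    ∫ ω, F (cappedHit X c t ω) (X (cappedHit X c t ω) ω) ∂P = F 0 x₀ := by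
  have hFc : ∀ y, Continuous fun s => F s y := fun y =>
    continuous_iff_continuousAt.2 fun s => (hF s y).continuousAt
  obtain ⟨B, hB⟩ := exists_norm_le_of_le hFc t
  obtain ⟨K, hK0, hK⟩ := exists_norm_step_le Q c hF hF' hQ t
  have hmesh : ∀ n : ℕ, ((n + 1 : ℕ) : ℝ≥0) * (t / (n + 1 : ℕ)) = t := fun n =>
    mul_div_cancel₀ t (by positivity)
  have hlim : Tendsto (fun n : ℕ => ∫ ω, gridStopped F X c (t / (n + 1 : ℕ)) (n + 1) ω ∂P) atTop
      (𝓝 (∫ ω, F (cappedHit X c t ω) (X (cappedHit X c t ω) ω) ∂P)) := by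
    refine tendsto_integral_of_dominated_convergence (fun _ => B)
      (fun n => hX.aestronglyMeasurable_gridStopped F c _ _) (integrable_const B)
      (fun n => Eventually.of_forall fun ω => ?_) ?_
    · obtain ⟨m, hm, heq⟩ := exists_gridStopped_eq F X c (t / (n + 1 : ℕ)) (n + 1) ω
      rw [heq]
      refine hB _ ?_ _
      calc (m : ℝ≥0) * (t / (n + 1 : ℕ)) ≤ ((n + 1 : ℕ) : ℝ≥0) * (t / (n + 1 : ℕ)) := by gcongr
        _ = t := hmesh n
    · filter_upwards [hX.rightContinuous] with ω hω using tendsto_gridStopped hFc hω ht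
  -- The indicator excludes the state `c` at the start of the step, so the one-step drift is of
  -- second order; the `n + 1` steps together contribute `O(1/n)`.
  have hstep : ∀ n k : ℕ, k < n + 1 →
      ‖∫ ω, {ω | ∀ j ≤ k, X (j * (t / (n + 1 : ℕ))) ω ≠ c}.indicator
        (fun ω => F ((k + 1 : ℕ) * (t / (n + 1 : ℕ)) : ℝ≥0) (X ((k + 1 : ℕ) * (t / (n + 1 : ℕ))) ω)
        - F ((k : ℝ≥0) * (t / (n + 1 : ℕ)) : ℝ≥0) (X (k * (t / (n + 1 : ℕ))) ω)) ω ∂P‖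
      ≤ K * (t / (n + 1)) ^ 2 := by
    intro n k hk
    set h : ℝ≥0 := t / (n + 1 : ℕ) with hh
    have hhr : (h : ℝ) = t / (n + 1) := by rw [hh]; push_cast; rfl
    set A := {ω | ∀ j ≤ k, X (j * h) ω ≠ c} with hAdef
    have hA := measurableSet_past_grid X c h k
    have hle : (k : ℝ≥0) * h ≤ (k + 1 : ℕ) * h := by gcongr; simp
    rw [hX.integral_indicator_sub hle hA]
    have hdiff : (((k + 1 : ℕ) * h : ℝ≥0) : ℝ) - ((k * h : ℝ≥0) : ℝ) = h := by push_cast; ring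
    have hadd : (((k + 1 : ℕ) * h : ℝ≥0) : ℝ) = ((k * h : ℝ≥0) : ℝ) + h := by push_cast; ring
    rw [hdiff, hadd]
    have htop : ((k * h : ℝ≥0) : ℝ) + h ≤ t := by
      rw [← hadd, NNReal.coe_le_coe, ← hmesh n]
      gcongr
      exact_mod_cast Nat.lt_succ_iff.1 hk
    have hmeas : MeasurableSet A := hX.past_le _ _ hA
    calc _ ≤ ∑ x, P.real (A ∩ {ω | X (k * h) ω = x}) * (K * h ^ 2) := by
          refine norm_sum_le_of_le _ fun x _ => ?_
          rw [norm_smul, Real.norm_of_nonneg measureReal_nonneg]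
          rcases eq_or_ne x c with rfl | hx
          · have : A ∩ {ω | X (k * h) ω = x} = ∅ := by
              ext ω
              simp only [Set.mem_inter_iff, Set.mem_ofPred_eq, Set.mem_empty_iff_false, iff_false,
                not_and]
              exact fun hω => hω k le_rfl
            rw [this, measureReal_empty, zero_mul, zero_mul]
          · exact mul_le_mul_of_nonneg_left (hK _ _ (NNReal.coe_nonneg _) h.2 htop x hx)
              measureReal_nonneg
      _ ≤ 1 * (K * h ^ 2) := by
          rw [← Finset.sum_mul]
          refine mul_le_mul_of_nonneg_right ?_ (by positivity)
          rw [← measureReal_biUnion_finset (fun x _ y _ hxy => ?_) (fun x _ =>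
            hmeas.inter (hX.measurableSet_eq _ x))]
          · exact measureReal_le_one
          · refine Set.disjoint_left.2 fun ω h1 h2 => hxy (h1.2.symm.trans h2.2)
      _ = K * (t / (n + 1)) ^ 2 := by rw [one_mul, hhr]
  have hbound : ∀ n : ℕ, ‖∫ ω, gridStopped F X c (t / (n + 1 : ℕ)) (n + 1) ω ∂P - F 0 x₀‖
      ≤ K * t ^ 2 / (n + 1) := by
    intro n
    have hi : ∀ k ∈ Finset.range (n + 1), Integrable
        ({ω | ∀ j ≤ k, X (j * (t / (n + 1 : ℕ))) ω ≠ c}.indicator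
        (fun ω => F ((k + 1 : ℕ) * (t / (n + 1 : ℕ)) : ℝ≥0) (X ((k + 1 : ℕ) * (t / (n + 1 : ℕ))) ω)
        - F ((k : ℝ≥0) * (t / (n + 1 : ℕ)) : ℝ≥0) (X (k * (t / (n + 1 : ℕ))) ω))) P :=
      fun k _ => hX.integrable_indicator_sub _ _
        (hX.past_le _ _ (measurableSet_past_grid X c _ k)) _ _
    have h0 : (fun ω => F 0 (X 0 ω)) =ᵐ[P] fun _ => F 0 x₀ := by
      filter_upwards [hX0] with ω hω
      rw [hω]
    unfold gridStopped
    rw [integral_add ((integrable_congr h0).2 (integrable_const _)) (integrable_finsetSum _ hi),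
      integral_finsetSum _ hi, integral_congr_ae h0, integral_const, probReal_univ, one_smul,
      add_sub_cancel_left]
    refine (norm_sum_le_of_le _ fun k hk => hstep n k (Finset.mem_range.1 hk)).trans (le_of_eq ?_)
    rw [Finset.sum_const, Finset.card_range, nsmul_eq_mul]
    push_cast
    field_simp
  have hzero : Tendsto (fun n : ℕ => K * (t : ℝ) ^ 2 / (n + 1)) atTop (𝓝 0) := by
    have := (tendsto_const_nhds (x := K * (t : ℝ) ^ 2)).div_atTop
      (tendsto_natCast_atTop_atTop (R := ℝ))
    exact (this.comp (tendsto_add_atTop_nat 1)).congr fun n => by simp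
  have hlim' := tendsto_iff_norm_sub_tendsto_zero.2
    (squeeze_zero (fun n => norm_nonneg _) hbound hzero)
  exact tendsto_nhds_unique hlim hlim'

end Dynkin

/-! ### Martingales of the Engset process. -/

section Engset

variable {E : Type*} [NormedAddCommGroup E] [NormedSpace ℝ E]

/-- Action of the generator of the Engset process off the blocking state. -/
theorem sum_engsetQ_smul (ν μ : ℝ) (N C : ℕ) {x : Fin (C + 1)} (hx : (x : ℕ) < C) (v : ℕ → E) :
    ∑ y, engsetQ ν μ N C x y • v y =
      (μ * (x : ℕ)) • (v (x - 1) - v x) + (ν * ((N : ℝ) - (x : ℕ))) • (v (x + 1) - v x) := by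
  have hsplit : ∀ y : Fin (C + 1), engsetQ ν μ N C x y • v y =
      (fun y : ℕ => (if y + 1 = (x : ℕ) then (μ * (x : ℕ)) • v (x - 1) else 0)
        + (if y = (x : ℕ) + 1 then (ν * ((N : ℝ) - (x : ℕ))) • v (x + 1) else 0)
        + (if y = (x : ℕ) then (-(μ * (x : ℕ) + ν * ((N : ℝ) - (x : ℕ)))) • v x else 0)) y := by
    intro y
    simp only [engsetQ, Matrix.of_apply, if_pos hx, Fin.ext_iff]
    split_ifs with h1 <;> try omega
    · simp [← h1]
    · simp [‹(y : ℕ) = (x : ℕ) + 1›]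
    · simp [‹(y : ℕ) = (x : ℕ)›]
    · simp
  simp_rw [hsplit]
  rw [Fin.sum_univ_eq_sum_range (fun y : ℕ =>
        (if y + 1 = (x : ℕ) then (μ * (x : ℕ)) • v (x - 1) else 0)
        + (if y = (x : ℕ) + 1 then (ν * ((N : ℝ) - (x : ℕ))) • v (x + 1) else 0)
        + (if y = (x : ℕ) then (-(μ * (x : ℕ) + ν * ((N : ℝ) - (x : ℕ)))) • v x else 0)) (C + 1),
    Finset.sum_add_distrib, Finset.sum_add_distrib, Finset.sum_ite_eq', Finset.sum_ite_eq',
    if_pos (Finset.mem_range.2 (by omega)), if_pos (Finset.mem_range.2 (by omega))]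
  have hdown : ∑ y ∈ Finset.range (C + 1),
      (if y + 1 = (x : ℕ) then (μ * (x : ℕ)) • v (x - 1) else 0)
      = (μ * (x : ℕ)) • v (x - 1) := by
    -- At `x = 0` the truncated `x - 1` is harmless, since its coefficient `μ x` vanishes.
    rcases Nat.eq_zero_or_pos (x : ℕ) with h0 | h0
    · simp [h0]
    · rw [Finset.sum_eq_single ((x : ℕ) - 1)]
      · rw [if_pos (by omega)]
      · intro y _ hy
        rw [if_neg (by omega)]
      · intro h
        exact absurd (Finset.mem_range.2 (by omega)) h
  rw [hdown]
  module

variable {Ω : Type*} [MeasurableSpace Ω] {P : Measure Ω} [IsProbabilityMeasure P] {ν μ : ℝ}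
  {N C : ℕ} {X : ℝ≥0 → Ω → Fin (C + 1)}

/-- The equation is required only below `C`, so the truncation at `C` plays no role and `F` may come
from the system without blocking. -/
theorem IsEngsetProcess.integral_cappedHit [CompleteSpace E] (hX : IsEngsetProcess ν μ N C X P)
    (hX0 : ∀ᵐ ω ∂P, X 0 ω = 0) {F F' : ℝ → ℕ → E}
    (hF : ∀ s x, HasDerivAt (fun s => F s x) (F' s x) s) (hF' : ∀ x, Continuous fun s => F' s x)
    (hQ : ∀ s, ∀ x < C, F' s x + ((μ * (x : ℕ)) • (F s (x - 1) - F s x)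
      + (ν * ((N : ℝ) - (x : ℕ))) • (F s (x + 1) - F s x)) = 0) {t : ℝ≥0} (ht : 0 < t) :
    ∫ ω, F (cappedHit X (Fin.last C) t ω) (X (cappedHit X (Fin.last C) t ω) ω) ∂P = F 0 0 := by
  have h := IsMarkovJumpProcess.integral_cappedHit hX hX0 (Fin.last C)
    (F := fun s x => F s x) (F' := fun s x => F' s x) (fun s y => hF s y) (fun y => hF' y)
    (fun s x hx => by
      have hxC : (x : ℕ) < C := Fin.val_lt_last hx
      rw [sum_engsetQ_smul ν μ N C hxC (F s)]
      exact hQ s x hxC) ht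
  simpa using h

/-- The increments of the mean hitting time of the blocking state. -/
noncomputable def hitIncrement (ν μ : ℝ) (N : ℕ) : ℕ → ℝ
  | 0 => 1 / (ν * N)
  | x + 1 => (1 + μ * (x + 1) * hitIncrement ν μ N x) / (ν * (N - (x + 1)))

theorem hitIncrement_nonneg (hν : 0 < ν) (hμ : 0 ≤ μ) {x : ℕ} (hx : x < N) :
    0 ≤ hitIncrement ν μ N x := by
  induction x with
  | zero => rw [hitIncrement]; positivity
  | succ x ih =>
    have h1 : (x : ℝ) + 1 < N := by exact_mod_cast hx
    have h2 := ih (by omega)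
    rw [hitIncrement]
    have h3 : (0 : ℝ) ≤ N - (x + 1) := by linarith
    positivity

/-- First-step analysis: the partial sums `H` of the increments satisfy `L H = 1` for the generator
`L`, so that `H(X_s) - s` has no drift below `C`. -/
theorem hitIncrement_balance (hν : 0 < ν) {x : ℕ} (hx : x < N) :
    ν * (N - x) * hitIncrement ν μ N x
      = 1 + μ * x * (∑ i ∈ Finset.range x, hitIncrement ν μ N i
        - ∑ i ∈ Finset.range (x - 1), hitIncrement ν μ N i) := by
  have hx' : (x : ℝ) < N := by exact_mod_cast hx
  have hne : (N : ℝ) - x ≠ 0 := by linarith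
  cases x with
  | zero =>
    have hN : (N : ℝ) ≠ 0 := by simpa using hne
    simp only [hitIncrement]
    field_simp
    simp
  | succ x =>
    rw [Nat.add_sub_cancel, Finset.sum_range_succ]
    push_cast at hne ⊢
    rw [hitIncrement]
    field_simp
    ring

/-- Dynkin's formula for `H(x) - s` bounds `E[T ∧ t]` by `H(C)` for every `t`; Markov's inequality
then gives `P(T = ⊤) ≤ H(C) / t`. -/
theorem IsEngsetProcess.ae_blockingTime_ne_top (hX : IsEngsetProcess ν μ N C X P)
    (hX0 : ∀ᵐ ω ∂P, X 0 ω = 0) (hν : 0 < ν) (hμ : 0 ≤ μ) (hCN : C ≤ N) :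
    ∀ᵐ ω ∂P, blockingTime X ω ≠ ⊤ := by
  set H : ℕ → ℝ := fun x => ∑ i ∈ Finset.range x, hitIncrement ν μ N i with hH
  set c := Fin.last C with hc
  have hHle : ∀ x : Fin (C + 1), H x ≤ H C := fun x =>
    Finset.sum_le_sum_of_subset_of_nonneg (Finset.range_mono (Nat.lt_succ_iff.1 x.2))
      fun i hi _ => hitIncrement_nonneg hν hμ (lt_of_lt_of_le (Finset.mem_range.1 hi) hCN)
  have hint1 : ∀ t : ℝ≥0, 0 < t → Integrable (fun ω => (cappedHit X c t ω : ℝ)) P := fun t ht =>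
    IsMarkovJumpProcess.integrable_cappedHit hX (F := fun s _ => s) (fun _ => continuous_id) c ht
  have hint2 : ∀ t : ℝ≥0, 0 < t → Integrable (fun ω => H (X (cappedHit X c t ω) ω)) P :=
    fun t ht => IsMarkovJumpProcess.integrable_cappedHit hX (F := fun _ x => H x)
      (fun _ => continuous_const) c ht
  have hmean : ∀ t : ℝ≥0, 0 < t → ∫ ω, (cappedHit X c t ω : ℝ) ∂P ≤ H C := by
    intro t ht
    have h := hX.integral_cappedHit hX0 (F := fun s x => H x - s) (F' := fun _ _ => -1)
      (fun s x => (hasDerivAt_id s).const_sub (H x)) (fun _ => continuous_const)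
      (fun s x hx => by
        have hb := hitIncrement_balance (μ := μ) hν (lt_of_lt_of_le hx hCN)
        have hs : H (x + 1) - H x = hitIncrement ν μ N x := by
          simp [hH, Finset.sum_range_succ]
        simp only [smul_eq_mul, sub_sub_sub_cancel_right]
        rw [hs, hb]
        simp only [hH]
        ring) ht
    rw [integral_sub (hint2 t ht) (hint1 t ht)] at h
    have h2 : ∫ ω, H (X (cappedHit X c t ω) ω) ∂P ≤ H C := by
      calc _ ≤ ∫ _, H C ∂P := integral_mono (hint2 t ht) (integrable_const _) fun ω => hHle _
        _ = H C := by simp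
    have h0 : H 0 = 0 := by simp [hH]
    linarith
  have hbound : ∀ n : ℕ, P.real {ω | blockingTime X ω = ⊤} ≤ H C / (n + 1 : ℕ) := by
    intro n
    have ht : (0 : ℝ≥0) < (n + 1 : ℕ) := by positivity
    have h1 := mul_meas_ge_le_integral_of_nonneg (μ := P)
      (f := fun ω => (cappedHit X c (n + 1 : ℕ) ω : ℝ))
      (Eventually.of_forall fun ω => NNReal.coe_nonneg _) (hint1 _ ht) ((n + 1 : ℕ) : ℝ)
    rw [le_div_iff₀ (by positivity), mul_comm]
    refine le_trans (mul_le_mul_of_nonneg_left (measureReal_mono fun ω hω => ?_)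
      (by positivity)) (h1.trans (hmean _ ht))
    have : hittingAfter X {c} 0 ω = ⊤ := hω
    change ((n + 1 : ℕ) : ℝ) ≤ (cappedHit X c (n + 1 : ℕ) ω : ℝ)
    rw [cappedHit_of_le (by rw [this]; exact le_top)]
    simp
  have hzero : P.real {ω | blockingTime X ω = ⊤} ≤ 0 :=
    ge_of_tendsto' ((tendsto_const_div_atTop_nhds_zero_nat (H C)).comp
      (tendsto_add_atTop_nat 1)) hbound
  rw [ae_iff]
  simpa using (measureReal_eq_zero_iff (μ := P)).1 (le_antisymm hzero measureReal_nonneg)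

/-- The blocking time is measurable up to null sets. -/
theorem IsEngsetProcess.aemeasurable_blockingTime (hX : IsEngsetProcess ν μ N C X P)
    (hfin : ∀ᵐ ω ∂P, blockingTime X ω ≠ ⊤) :
    AEMeasurable (fun ω => (((blockingTime X ω).untopD 0 : ℝ≥0) : ℝ)) P := by
  refine aemeasurable_of_tendsto_metrizable_ae atTop
    (f := fun (n : ℕ) ω => (cappedHit X (Fin.last C) (n + 1 : ℕ) ω : ℝ)) (fun n =>
      (IsMarkovJumpProcess.aestronglyMeasurable_cappedHit hX (F := fun s _ => s)
        (fun _ => continuous_id) (Fin.last C) (by positivity)).aemeasurable) ?_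
  filter_upwards [hfin] with ω hω
  obtain ⟨u, hu⟩ := WithTop.ne_top_iff_exists.1 hω
  refine tendsto_const_nhds.congr' ?_
  filter_upwards [eventually_ge_atTop ⌈u⌉₊] with n hn
  rw [← hu, cappedHit_of_lt hu.symm, WithTop.untopD_coe]
  exact (Nat.le_ceil u).trans (by exact_mod_cast hn.trans (Nat.le_succ n))

/-- The exponential martingale of the Engset process. -/
theorem IsEngsetProcess.integral_exponential_cappedHit (hX : IsEngsetProcess ν μ N C X P)
    (hX0 : ∀ᵐ ω ∂P, X 0 ω = 0) (hνμ : ν + μ = 1) (hCN : C ≤ N) (u : ℂ) {t : ℝ≥0} (ht : 0 < t) :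
    ∫ ω, (1 + u * μ * Real.exp (cappedHit X (Fin.last C) t ω)) ^
        (X (cappedHit X (Fin.last C) t ω) ω : ℕ) *
      (1 - u * ν * Real.exp (cappedHit X (Fin.last C) t ω)) ^
        (N - (X (cappedHit X (Fin.last C) t ω) ω : ℕ)) ∂P = (1 - u * ν) ^ N := by
  have hexp : ∀ s : ℝ, HasDerivAt (fun s : ℝ => (Real.exp s : ℂ)) (Real.exp s : ℂ) s := fun s =>
    (Real.hasDerivAt_exp s).ofReal_comp
  have hA : ∀ s : ℝ, HasDerivAt (fun s : ℝ => 1 + u * μ * (Real.exp s : ℂ))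
    (u * μ * Real.exp s) s := fun s => ((hexp s).const_mul _).const_add _
  have hB : ∀ s : ℝ, HasDerivAt (fun s : ℝ => 1 - u * ν * (Real.exp s : ℂ))
    (-(u * ν * Real.exp s)) s := fun s => ((hexp s).const_mul _).const_sub _
  have h := hX.integral_cappedHit hX0
    (F := fun s x => (1 + u * μ * Real.exp s) ^ x * (1 - u * ν * Real.exp s) ^ (N - x))
    (fun s x => ((hA s).pow x).mul ((hB s).pow (N - x)))
    (fun x => by fun_prop) (fun s x hx => by
      obtain ⟨m, rfl⟩ : ∃ m, N = x + m + 1 := ⟨N - x - 1, by omega⟩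
      have hm : x + m + 1 - x = m + 1 := by omega
      have hm' : x + m + 1 - (x + 1) = m := by omega
      have hν : (ν : ℂ) + μ = 1 := by exact_mod_cast hνμ
      simp only [Pi.pow_apply, Complex.real_smul, hm, hm', Nat.add_sub_cancel]
      push_cast
      set e := Complex.exp s
      cases x with
      | zero =>
        simp only [Nat.cast_zero, pow_zero, zero_mul, mul_zero, zero_add, one_mul, sub_zero]
        linear_combination (-(m + 1) * ν * u * e * (1 - u * ν * e) ^ m) * (-1) * (hν)
      | succ x =>
        have hx1 : x + 1 + m + 1 - x = m + 2 := by omega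
        simp only [Nat.add_sub_cancel, hx1]
        push_cast
        linear_combination ((x + 1) * μ * u * e * (1 + u * μ * e) ^ x * (1 - u * ν * e) ^ (m + 1)
          - (m + 1) * ν * u * e * (1 + u * μ * e) ^ (x + 1) * (1 - u * ν * e) ^ m) * (-1) * hν) ht
  simpa using h

/-- The second moment of the centred process at the capped blocking time. -/
theorem IsEngsetProcess.integral_sq_cappedHit_le (hX : IsEngsetProcess ν μ N C X P)
    (hX0 : ∀ᵐ ω ∂P, X 0 ω = 0) (hνμ : ν + μ = 1) (hν : 0 < ν) (hμ : 0 ≤ μ) (hCN : C ≤ N)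
    {t : ℝ≥0} (ht : 0 < t) :
    ∫ ω, (Real.exp (cappedHit X (Fin.last C) t ω) *
        ((X (cappedHit X (Fin.last C) t ω) ω : ℕ) - ν * N) + ν * N) ^ 2 ∂P
      ≤ Real.exp (2 * t) * N := by
  set c := Fin.last C with hc
  have hexp : ∀ s : ℝ, HasDerivAt (fun s : ℝ => Real.exp (2 * s)) (2 * Real.exp (2 * s)) s :=
    fun s => by simpa [mul_comm] using ((hasDerivAt_id s).const_mul 2).exp
  -- The function comes from the coefficients of `u` and `u²` in the exponential martingale,
  -- recentred so that its square part starts at `0`. The subtracted term is the compensator.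
  have h := hX.integral_cappedHit hX0
    (F := fun s x => (Real.exp s * ((x : ℕ) - ν * N) + ν * N) ^ 2
      - Real.exp (2 * s) * (μ ^ 2 * (x : ℕ) + ν ^ 2 * (N - (x : ℕ))))
    (fun s x => ((((Real.hasDerivAt_exp s).mul_const _).add_const _).pow 2).sub
      ((hexp s).mul_const _))
    (fun x => by fun_prop) (fun s x hx => by
      have h2 : Real.exp (2 * s) = Real.exp s ^ 2 := by rw [← Real.exp_nat_mul]; norm_num
      obtain rfl : μ = 1 - ν := by linarith
      simp only [smul_eq_mul, h2]
      cases x with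
      | zero => simp; ring
      | succ x =>
        simp only [Nat.add_sub_cancel]
        push_cast
        ring) ht
  have hint1 : Integrable (fun ω => (Real.exp (cappedHit X c t ω) *
        ((X (cappedHit X c t ω) ω : ℕ) - ν * N) + ν * N) ^ 2) P :=
    IsMarkovJumpProcess.integrable_cappedHit hX
      (F := fun s x => (Real.exp s * ((x : ℕ) - ν * N) + ν * N) ^ 2) (fun _ => by fun_prop) c ht
  have hint2 : Integrable (fun ω => Real.exp (2 * cappedHit X c t ω) *
        (μ ^ 2 * (X (cappedHit X c t ω) ω : ℕ) + ν ^ 2 * (N - (X (cappedHit X c t ω) ω : ℕ)))) P :=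
    IsMarkovJumpProcess.integrable_cappedHit hX
      (F := fun s x => Real.exp (2 * s) * (μ ^ 2 * (x : ℕ) + ν ^ 2 * (N - (x : ℕ))))
      (fun _ => by fun_prop) c ht
  rw [integral_sub hint1 hint2] at h
  have hle : ∫ ω, Real.exp (2 * cappedHit X c t ω) * (μ ^ 2 * (X (cappedHit X c t ω) ω : ℕ)
      + ν ^ 2 * (N - (X (cappedHit X c t ω) ω : ℕ))) ∂P ≤ Real.exp (2 * t) * N := by
    calc _ ≤ ∫ _, Real.exp (2 * t) * N ∂P := by
          refine integral_mono hint2 (integrable_const _) fun ω => ?_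
          have hx : ((X (cappedHit X c t ω) ω : ℕ) : ℝ) ≤ N := by
            exact_mod_cast (Nat.lt_succ_iff.1 (X (cappedHit X c t ω) ω).2).trans hCN
          have hτ : (cappedHit X c t ω : ℝ) ≤ t := cappedHit_le X c t ω
          have hx0 : (0 : ℝ) ≤ (X (cappedHit X c t ω) ω : ℕ) := Nat.cast_nonneg _
          have hμ2 : μ ^ 2 ≤ 1 := by nlinarith
          have hν2 : ν ^ 2 ≤ 1 := by nlinarith
          have h1 : μ ^ 2 * ((X (cappedHit X c t ω) ω : ℕ) : ℝ)
              + ν ^ 2 * (N - (X (cappedHit X c t ω) ω : ℕ)) ≤ N := by nlinarith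
          calc _ ≤ Real.exp (2 * cappedHit X c t ω) * N :=
                mul_le_mul_of_nonneg_left h1 (Real.exp_pos _).le
            _ ≤ _ := by gcongr
      _ = _ := by simp
  have h0 : (Real.exp 0 * (((0 : ℕ) : ℝ) - ν * N) + ν * N) ^ 2
      - Real.exp (2 * 0) * (μ ^ 2 * ((0 : ℕ) : ℝ) + ν ^ 2 * (N - ((0 : ℕ) : ℝ))) ≤ 0 := by
    simp
    positivity
  linarith

end Engset

/-! ### Expansion of the exponential martingale. -/

section Expansion

open Complex (I)

/-- Taylor's formula for the logarithm. With `z` of order `N^(-1/2)` and `m ≤ N`, the total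
remainder `m r` is `O(N^(-1/2))`. -/
theorem Complex.exists_one_add_pow_eq_exp {z : ℂ} (hz : ‖z‖ ≤ 1 / 2) (m : ℕ) :
    ∃ r : ℂ, ‖r‖ ≤ ‖z‖ ^ 3 ∧ (1 + z) ^ m = Complex.exp (m * (z - z ^ 2 / 2 + r)) := by
  refine ⟨Complex.log (1 + z) - (z - z ^ 2 / 2), ?_, ?_⟩
  · have h := Complex.norm_log_sub_logTaylor_le 2 (z := z) (by linarith)
    have ht : Complex.logTaylor (2 + 1) z = z - z ^ 2 / 2 := by
      simp [Complex.logTaylor, Finset.sum_range_succ]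
      ring
    rw [ht] at h
    refine h.trans ?_
    have h2 : (1 - ‖z‖)⁻¹ ≤ 2 := by
      rw [inv_le_comm₀ (by linarith) (by norm_num)]
      linarith
    have h3 : 0 ≤ ‖z‖ ^ 3 := by positivity
    norm_num
    nlinarith
  · have hne : 1 + z ≠ 0 := by
      intro h0
      have : z = -1 := by linear_combination h0
      rw [this] at hz
      norm_num at hz
    rw [add_sub_cancel, Complex.exp_nat_mul, Complex.exp_log hne]

/-- A purely imaginary perturbation changes the modulus only at second order, so the power stays
bounded when `m b²` does. -/
theorem Complex.norm_one_add_I_mul_pow_le (b : ℝ) (m : ℕ) :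
    ‖(1 + I * b : ℂ) ^ m‖ ≤ Real.exp (m * b ^ 2) := by
  rw [norm_pow, Real.exp_nat_mul]
  refine pow_le_pow_left₀ (norm_nonneg _) ?_ m
  have h1 : ‖(1 + I * b : ℂ)‖ ^ 2 = 1 + b ^ 2 := by
    rw [← Complex.normSq_eq_norm_sq, Complex.normSq_apply]
    simp
    ring
  have h2 : ‖(1 + I * b : ℂ)‖ ≤ 1 + b ^ 2 :=
    abs_le_of_sq_le_sq' (by rw [h1]; nlinarith [sq_nonneg b]) (by positivity) |>.2
  linarith [Real.add_one_le_exp (b ^ 2)]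

theorem Complex.norm_exp_sub_exp_le {z w : ℂ} {K : ℝ} (hz : ‖Complex.exp z‖ ≤ K)
    (hw : ‖Complex.exp w‖ ≤ K) : ‖Complex.exp z - Complex.exp w‖ ≤ 2 * K * ‖z - w‖ := by
  have hK : 0 ≤ K := (norm_nonneg _).trans hz
  rcases le_or_gt ‖z - w‖ 1 with h | h
  · have h1 : Complex.exp z - Complex.exp w = Complex.exp w * (Complex.exp (z - w) - 1) := by
      rw [mul_sub, ← Complex.exp_add, add_sub_cancel, mul_one]
    rw [h1, norm_mul]
    calc _ ≤ K * (2 * ‖z - w‖) := by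
          gcongr
          exact Complex.norm_exp_sub_one_le h
      _ = _ := by ring
  · calc _ ≤ K + K := (norm_sub_le _ _).trans (add_le_add hz hw)
      _ = 2 * K * 1 := by ring
      _ ≤ _ := by gcongr

/-- Only an upper bound on `d` is needed: for `d < -1` the left side is at most `-d ≤ d²`. -/
theorem Real.abs_exp_sub_one_sub_le {d : ℝ} (hd : d ≤ 1) : |Real.exp d - 1 - d| ≤ d ^ 2 := by
  rcases le_or_gt (-1) d with h | h
  · exact Real.abs_exp_sub_one_sub_id_le (abs_le.2 ⟨h, hd⟩)
  · have h1 := Real.add_one_le_exp d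
    have h2 : Real.exp d ≤ 1 := Real.exp_le_one_iff.2 (by linarith)
    rw [abs_of_nonneg (by linarith)]
    nlinarith

theorem Real.abs_le_mul_abs_exp_sub_one {d s : ℝ} (hs : 0 ≤ s) (hd : -s ≤ d) :
    |d| ≤ Real.exp s * |Real.exp d - 1| := by
  have h1s : 1 ≤ Real.exp s := Real.one_le_exp hs
  rcases le_or_gt 0 d with h | h
  · have h1 := Real.add_one_le_exp d
    rw [abs_of_nonneg h, abs_of_nonneg (by linarith)]
    nlinarith
  · have h1 := Real.add_one_le_exp (-d)
    have h2 : Real.exp d < 1 := by simpa using Real.exp_lt_exp.2 h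
    rw [abs_of_neg h, abs_of_neg (by linarith)]
    have h3 : Real.exp (-d) * Real.exp d = 1 := by rw [← Real.exp_add]; simp
    have h4 : Real.exp (-d) ≤ Real.exp s := Real.exp_le_exp.2 (by linarith)
    nlinarith [Real.exp_pos d]

variable {ν μ η θ : ℝ}

/-- Second-order expansion of the exponential martingale. -/
theorem exists_exponential_eq_exp (hν : 0 ≤ ν) (hμ : 0 ≤ μ) (hνμ : ν + μ = 1) {N x : ℕ}
    (hx : x ≤ N) {n a A : ℝ} (hn : 0 < n) (hnN : n ^ 2 = N) (ha : 0 ≤ a) (haA : a ≤ A)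
    (hsmall : |θ| * A / n ≤ 1 / 2) :
    ∃ R : ℂ, ‖R‖ ≤ (|θ| * A) ^ 3 / n ∧
      (1 + (I * θ / n : ℂ) * μ * a) ^ x * (1 - (I * θ / n : ℂ) * ν * a) ^ (N - x) =
        Complex.exp (I * (θ * (a * (x - ν * N) / n) : ℝ)
          + (θ ^ 2 * (a ^ 2 * (μ ^ 2 * x + ν ^ 2 * (N - x)) / N) / 2 : ℝ) + R) := by
  have hnorm : ∀ c : ℝ, 0 ≤ c → c ≤ 1 → ‖(I * θ / n : ℂ) * c * a‖ ≤ |θ| * A / n := by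
    intro c hc hc1
    rw [norm_mul, norm_mul, norm_div, norm_mul, Complex.norm_I, Complex.norm_real,
      Complex.norm_real, Complex.norm_real, Complex.norm_real, Real.norm_of_nonneg hc,
      Real.norm_of_nonneg hn.le, Real.norm_of_nonneg ha, Real.norm_eq_abs, one_mul]
    calc |θ| / n * c * a ≤ |θ| / n * 1 * A := by gcongr
      _ = |θ| * A / n := by ring
  have h1 := hnorm μ hμ (by linarith)
  have h2 := hnorm ν hν (by linarith)
  rw [← norm_neg] at h2
  obtain ⟨r₁, hr₁, he₁⟩ := Complex.exists_one_add_pow_eq_exp (h1.trans hsmall) x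
  obtain ⟨r₂, hr₂, he₂⟩ := Complex.exists_one_add_pow_eq_exp (h2.trans hsmall) (N - x)
  have hr₁' := hr₁.trans (pow_le_pow_left₀ (norm_nonneg _) h1 3)
  have hr₂' := hr₂.trans (pow_le_pow_left₀ (norm_nonneg _) h2 3)
  refine ⟨x * r₁ + (N - x : ℕ) * r₂, ?_, ?_⟩
  · calc ‖(x : ℂ) * r₁ + (N - x : ℕ) * r₂‖
        ≤ x * (|θ| * A / n) ^ 3 + (N - x : ℕ) * (|θ| * A / n) ^ 3 := by
          refine (norm_add_le _ _).trans ?_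
          rw [norm_mul, norm_mul, Complex.norm_natCast, Complex.norm_natCast]
          gcongr
      _ = n ^ 2 * (|θ| * A / n) ^ 3 := by
          rw [hnN, Nat.cast_sub hx]; ring
      _ = (|θ| * A) ^ 3 / n := by field_simp
  · rw [sub_eq_add_neg, he₁, he₂, ← Complex.exp_add]
    congr 1
    rw [Nat.cast_sub hx, ← hnN]
    have hNc : (N : ℂ) = (n : ℂ) ^ 2 := by exact_mod_cast hnN.symm
    have hnc : (n : ℂ) ≠ 0 := by exact_mod_cast hn.ne'
    have hμc : (μ : ℂ) = 1 - ν := by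
      have : (ν : ℂ) + μ = 1 := by exact_mod_cast hνμ
      linear_combination this
    push_cast
    rw [hNc, hμc]
    field_simp
    ring_nf
    simp only [Complex.I_sq]
    ring

theorem norm_exponential_le (hν : 0 ≤ ν) (hμ : 0 ≤ μ) (hνμ : ν + μ = 1) {N x : ℕ}
    (hx : x ≤ N) {n a A : ℝ} (hn : 0 < n) (hnN : n ^ 2 = N) (ha : 0 ≤ a) (haA : a ≤ A) :
    ‖(1 + (I * θ / n : ℂ) * μ * a) ^ x * (1 - (I * θ / n : ℂ) * ν * a) ^ (N - x)‖
      ≤ Real.exp (θ ^ 2 * A ^ 2) := by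
  have h1 : (1 + (I * θ / n : ℂ) * μ * a) = 1 + I * ((θ * μ * a / n : ℝ) : ℂ) := by
    push_cast; ring
  have h2 : (1 - (I * θ / n : ℂ) * ν * a) = 1 + I * ((-(θ * ν * a / n) : ℝ) : ℂ) := by
    push_cast; ring
  rw [h1, h2, norm_mul]
  refine (mul_le_mul (Complex.norm_one_add_I_mul_pow_le _ _)
    (Complex.norm_one_add_I_mul_pow_le _ _) (norm_nonneg _) (Real.exp_pos _).le).trans ?_
  rw [← Real.exp_add]
  refine Real.exp_le_exp.2 ?_
  have hb : ∀ c : ℝ, 0 ≤ c → c ≤ 1 → (θ * c * a / n) ^ 2 ≤ θ ^ 2 * A ^ 2 / N := by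
    intro c hc hc1
    rw [div_pow, hnN, mul_pow, mul_pow]
    have hc2 : c ^ 2 ≤ 1 := pow_le_one₀ hc hc1
    calc _ ≤ θ ^ 2 * 1 * A ^ 2 / N := by gcongr
      _ = _ := by ring
  have hN : (0 : ℝ) < N := by rw [← hnN]; positivity
  rw [neg_sq]
  calc _ ≤ (x : ℝ) * (θ ^ 2 * A ^ 2 / N) + (N - x : ℕ) * (θ ^ 2 * A ^ 2 / N) := by
        gcongr
        · exact hb μ hμ (by linarith)
        · exact hb ν hν (by linarith)
    _ = θ ^ 2 * A ^ 2 := by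
        rw [Nat.cast_sub hx]
        field_simp
        ring

/-- Linearisation of the exponent of the exponential martingale at the hitting time of a level
close to `η N`, around the deterministic hitting time `t₀`. -/
theorem norm_exponent_sub_le (hν : 0 ≤ ν) (hμ : 0 ≤ μ) (hνμ : ν + μ = 1) (hη : 0 ≤ η)
    (hην : η < ν) {N C : ℕ} {n B t₀ T : ℝ} (hn : 1 ≤ n) (hnN : n ^ 2 = N)
    (hB : |(C : ℝ) - η * N| ≤ B) (ht₀ : Real.exp t₀ * (ν - η) = ν) (hT : T ≤ t₀ + 1) :
    ‖(I * (θ * (Real.exp T * (C - ν * N) / n) : ℝ)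
        + (θ ^ 2 * (Real.exp T ^ 2 * (μ ^ 2 * C + ν ^ 2 * (N - C)) / N) / 2 : ℝ) : ℂ)
      - (-(I * (θ * ν * (n * (T - t₀)) : ℝ)) - I * (θ * n * ν : ℝ)
        + (θ ^ 2 * (Real.exp t₀ ^ 2 * (μ ^ 2 * η + ν ^ 2 * (1 - η))) / 2 : ℝ))‖
      ≤ (|θ| * (1 + Real.exp (t₀ + 1) * B)
        + θ ^ 2 * (Real.exp (t₀ + 1) ^ 2 * (B + 4))) * (1 / n + n * (T - t₀) ^ 2) := by
  set A := Real.exp (t₀ + 1) with hA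
  set a₀ := Real.exp t₀ with ha₀
  set a := Real.exp T with ha
  set δ := T - t₀ with hδ
  set e := 1 / n + n * δ ^ 2 with he
  have hn0 : 0 < n := by linarith
  have hN : (0 : ℝ) < N := by rw [← hnN]; positivity
  have hB0 : 0 ≤ B := (abs_nonneg _).trans hB
  have hA0 : 0 < A := Real.exp_pos _
  have ha0 : 0 < a := Real.exp_pos _
  have ha00 : 0 < a₀ := Real.exp_pos _
  have haA : a ≤ A := Real.exp_le_exp.2 hT
  have ha₀A : a₀ ≤ A := Real.exp_le_exp.2 (by linarith)
  have haδ : a = a₀ * Real.exp δ := by rw [ha, ha₀, ← Real.exp_add]; congr 1; rw [hδ]; ring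
  have hexp := Real.abs_exp_sub_one_sub_le (d := δ) (by linarith)
  have hν1 : ν ≤ 1 := by linarith
  have hδ2 : δ ^ 2 ≤ n * δ ^ 2 := le_mul_of_one_le_left (sq_nonneg _) hn
  have hinv : 0 < 1 / n := by positivity
  have he0 : 0 ≤ e := by positivity
  have h1e : 1 / n ≤ e := le_add_of_nonneg_right (by positivity)
  have h2e : n * δ ^ 2 ≤ e := le_add_of_nonneg_left hinv.le
  -- By the arithmetic-geometric mean inequality, `2|δ| ≤ 1/n + n δ²`.
  have hδe : |δ| ≤ e := by
    have h1 : 1 / n * n = 1 := by field_simp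
    have h3 : 0 ≤ n * (|δ| - 1 / n) ^ 2 := by positivity
    have h4 : n * (|δ| - 1 / n) ^ 2 = n * δ ^ 2 - 2 * |δ| + 1 / n := by
      rw [sub_sq, sq_abs]; field_simp
    have h5 := abs_nonneg δ
    linarith
  have hlin : |a * (C - ν * N) / n + ν * (n * δ) + n * ν| ≤ (1 + A * B) * e := by
    -- Since `a₀ (ν - η) = ν`, replacing `C` by `ηN` turns the first term into `-ν n e^δ`. What
    -- remains is the rounding error of `C` and the second-order remainder of `e^δ`.
    have heq : a * (C - ν * N) / n + ν * (n * δ) + n * ν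
        = a * (C - η * N) * (1 / n) - ν * n * (Real.exp δ - 1 - δ) := by
      rw [haδ, ← hnN]
      field_simp
      linear_combination (-(n ^ 2 * Real.exp δ)) * ht₀
    rw [heq]
    calc _ ≤ |a * (C - η * N) * (1 / n)| + |ν * n * (Real.exp δ - 1 - δ)| := abs_sub _ _
      _ ≤ A * B * (1 / n) + 1 * n * δ ^ 2 := by
          rw [abs_mul, abs_mul, abs_mul, abs_mul, abs_of_pos ha0, abs_of_pos hinv,
            abs_of_nonneg hν, abs_of_pos hn0]
          gcongr
      _ ≤ A * B * e + e := by
          rw [one_mul]; gcongr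
      _ = _ := by ring
  have hquad : |a ^ 2 * (μ ^ 2 * C + ν ^ 2 * (N - C)) / N
      - a₀ ^ 2 * (μ ^ 2 * η + ν ^ 2 * (1 - η))| ≤ A ^ 2 * (B + 4) * e := by
    have heq : a ^ 2 * (μ ^ 2 * C + ν ^ 2 * (N - C)) / N
        - a₀ ^ 2 * (μ ^ 2 * η + ν ^ 2 * (1 - η))
        = a ^ 2 * ((μ - ν) * (C - η * N) * (1 / N))
          + (a + a₀) * (a₀ * (Real.exp δ - 1)) * (μ ^ 2 * η + ν ^ 2 * (1 - η)) := by
      have hfac : a₀ * (Real.exp δ - 1) = a - a₀ := by rw [haδ]; ring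
      rw [hfac]
      obtain rfl : μ = 1 - ν := by linarith
      field_simp
      ring
    have hκ : |μ ^ 2 * η + ν ^ 2 * (1 - η)| ≤ 1 := by
      have hμ2 : μ ^ 2 ≤ 1 := pow_le_one₀ hμ (by linarith)
      have hν2 : ν ^ 2 ≤ 1 := pow_le_one₀ hν hν1
      have h1 : 0 ≤ 1 - η := by linarith
      rw [abs_of_nonneg (by positivity)]
      linarith [mul_le_of_le_one_left hη hμ2, mul_le_of_le_one_left h1 hν2]
    have hμν : |μ - ν| ≤ 1 := abs_le.2 ⟨by linarith, by linarith⟩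
    have hN1 : 1 / (N : ℝ) ≤ e := by
      refine le_trans ?_ h1e
      rw [← hnN]
      gcongr
      exact le_self_pow₀ hn (by norm_num)
    have hd1 : |Real.exp δ - 1| ≤ 2 * e := by
      calc |Real.exp δ - 1| = |(Real.exp δ - 1 - δ) + δ| := by congr 1; ring
        _ ≤ δ ^ 2 + |δ| := (abs_add_le _ _).trans (by gcongr)
        _ ≤ 2 * e := by linarith
    rw [heq]
    calc _ ≤ |a ^ 2 * ((μ - ν) * (C - η * N) * (1 / N))|
          + |(a + a₀) * (a₀ * (Real.exp δ - 1)) * (μ ^ 2 * η + ν ^ 2 * (1 - η))| := abs_add_le _ _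
      _ ≤ A ^ 2 * (1 * B * e) + (A + A) * (A * (2 * e)) * 1 := by
          rw [abs_mul, abs_mul, abs_mul, abs_mul, abs_mul, abs_mul, abs_of_pos ha00,
            abs_of_pos (show 0 < a ^ 2 by positivity), abs_of_pos (show 0 < a + a₀ by positivity),
            abs_of_pos (show 0 < 1 / (N : ℝ) by positivity)]
          gcongr
      _ = _ := by ring
  have hsplit : (I * (θ * (a * (C - ν * N) / n) : ℝ)
        + (θ ^ 2 * (a ^ 2 * (μ ^ 2 * C + ν ^ 2 * (N - C)) / N) / 2 : ℝ) : ℂ)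
      - (-(I * (θ * ν * (n * δ) : ℝ)) - I * (θ * n * ν : ℝ)
        + (θ ^ 2 * (a₀ ^ 2 * (μ ^ 2 * η + ν ^ 2 * (1 - η))) / 2 : ℝ))
      = I * (θ * (a * (C - ν * N) / n + ν * (n * δ) + n * ν) : ℝ)
        + (θ ^ 2 * (a ^ 2 * (μ ^ 2 * C + ν ^ 2 * (N - C)) / N
          - a₀ ^ 2 * (μ ^ 2 * η + ν ^ 2 * (1 - η))) / 2 : ℝ) := by
    push_cast
    ring
  rw [hsplit]
  refine (norm_add_le _ _).trans ?_
  rw [norm_mul, Complex.norm_I, one_mul, Complex.norm_real, Complex.norm_real, Real.norm_eq_abs,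
    Real.norm_eq_abs, abs_mul, abs_div, abs_mul, abs_of_nonneg (sq_nonneg θ),
    abs_of_pos (show (0 : ℝ) < 2 by norm_num)]
  calc _ ≤ |θ| * ((1 + A * B) * e) + θ ^ 2 * (A ^ 2 * (B + 4) * e) := by
        refine add_le_add (by gcongr) ?_
        refine le_trans ?_ (mul_le_mul_of_nonneg_left hquad (sq_nonneg θ))
        exact half_le_self (by positivity)
    _ = _ := by ring

/-- The fluctuation of the hitting time is controlled by the centred process. -/
theorem mul_sq_sub_le (hν : 0 < ν) {N C : ℕ} {n B t₀ T : ℝ} (hn : 1 ≤ n)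
    (hnN : n ^ 2 = N) (hB : |(C : ℝ) - η * N| ≤ B) (ht₀ : Real.exp t₀ * (ν - η) = ν)
    (ht₀0 : 0 ≤ t₀) (hT0 : 0 ≤ T) (hT : T ≤ t₀ + 1) :
    n * (T - t₀) ^ 2 ≤ 2 * (Real.exp t₀ / ν) ^ 2 * (1 + (Real.exp (t₀ + 1) * B) ^ 2) *
      (1 / n + (Real.exp T * (C - ν * N) + ν * N) ^ 2 / n ^ 3) := by
  set δ := T - t₀ with hδ
  set Y := Real.exp T * (C - ν * N) + ν * N with hY
  have hn0 : 0 < n := by linarith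
  have hN : (0 : ℝ) < N := by rw [← hnN]; positivity
  have hTδ : Real.exp T = Real.exp t₀ * Real.exp δ := by
    rw [← Real.exp_add]; congr 1; rw [hδ]; ring
  -- At level `C` the centred process determines `δ` up to the rounding error of `C`.
  have hYeq : ν * N * (Real.exp δ - 1) = Real.exp T * (C - η * N) - Y := by
    rw [hY, hTδ]
    linear_combination (-(N * Real.exp δ)) * ht₀
  have h1 : ν * N * |Real.exp δ - 1| ≤ Real.exp (t₀ + 1) * B + |Y| := by
    calc ν * N * |Real.exp δ - 1| = |ν * N * (Real.exp δ - 1)| := by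
          rw [abs_mul, abs_of_pos (mul_pos hν hN)]
      _ ≤ |Real.exp T * (C - η * N)| + |Y| := by rw [hYeq]; exact abs_sub _ _
      _ ≤ _ := by
          rw [abs_mul, abs_of_pos (Real.exp_pos T)]
          gcongr
  have h2 := Real.abs_le_mul_abs_exp_sub_one ht₀0 (d := δ) (by linarith)
  have h3 : |δ| ≤ Real.exp t₀ / ν * ((Real.exp (t₀ + 1) * B + |Y|) / N) := by
    refine h2.trans ?_
    rw [div_mul_eq_mul_div, mul_div_assoc]
    refine mul_le_mul_of_nonneg_left ?_ (Real.exp_pos _).le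
    rw [div_div, le_div_iff₀ (by positivity)]
    linarith
  have h4 : δ ^ 2 ≤ (Real.exp t₀ / ν) ^ 2 * ((Real.exp (t₀ + 1) * B + |Y|) ^ 2 / N ^ 2) := by
    rw [← sq_abs, ← div_pow, ← mul_pow]
    exact pow_le_pow_left₀ (abs_nonneg _) h3 2
  set b := Real.exp (t₀ + 1) * B with hb
  set k := (Real.exp t₀ / ν) ^ 2 with hk
  have hk0 : 0 ≤ k := sq_nonneg _
  have h5 : (b + |Y|) ^ 2 ≤ 2 * (b ^ 2 + Y ^ 2) := by
    nlinarith [sq_nonneg (b - |Y|), sq_abs Y]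
  have hn3 : 1 / n ^ 3 ≤ 1 / n := by
    gcongr
    exact le_self_pow₀ hn (by norm_num)
  calc n * δ ^ 2 ≤ n * (k * (2 * (b ^ 2 + Y ^ 2) / N ^ 2)) := by
        gcongr
        exact h4.trans (by gcongr)
    _ = 2 * k * (b ^ 2 * (1 / n ^ 3) + Y ^ 2 / n ^ 3) := by
        rw [← hnN]
        field_simp
    _ ≤ 2 * k * ((1 + b ^ 2) * (1 / n) + (1 + b ^ 2) * (Y ^ 2 / n ^ 3)) := by
        have hy : 0 ≤ Y ^ 2 / n ^ 3 := by positivity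
        have hn1 : 0 ≤ 1 / n := by positivity
        gcongr
        · linarith
        · nlinarith [sq_nonneg b, mul_nonneg (sq_nonneg b) hy]
    _ = _ := by ring

/-- The exponential martingale at the capped hitting time is close to a constant multiple of the
characteristic function variable of the normalised hitting time. -/
theorem exists_norm_exponential_sub_le (hν : 0 < ν) (hμ : 0 ≤ μ) (hνμ : ν + μ = 1) (hη : 0 ≤ η)
    (hην : η < ν) (θ B : ℝ) {t₀ : ℝ} (ht₀ : Real.exp t₀ * (ν - η) = ν) (ht₀0 : 0 ≤ t₀) :
    ∃ K, 0 ≤ K ∧ ∃ n₀ : ℝ, ∀ (N : ℕ) (n : ℝ), n₀ ≤ n → 0 < n → n ^ 2 = N → ∀ C : ℕ, C ≤ N →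
      |(C : ℝ) - η * N| ≤ B → ∀ (T τ : ℝ) (x : ℕ), x ≤ C → 0 ≤ T →
      ((T = τ ∧ x = C ∧ τ ≤ t₀ + 1) ∨ τ = t₀ + 1) →
      ‖(1 + (I * θ / n : ℂ) * μ * (Real.exp τ : ℝ)) ^ x *
          (1 - (I * θ / n : ℂ) * ν * (Real.exp τ : ℝ)) ^ (N - x)
        - Complex.exp (-(I * (θ * ν * (n * (T - t₀)) : ℝ)) - I * (θ * n * ν : ℝ)
          + (θ ^ 2 * (Real.exp t₀ ^ 2 * (μ ^ 2 * η + ν ^ 2 * (1 - η))) / 2 : ℝ))‖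
      ≤ K * (1 / n + (Real.exp τ * (x - ν * N) + ν * N) ^ 2 / n ^ 3) := by
  set A := Real.exp (t₀ + 1) with hA
  set q := θ ^ 2 * (Real.exp t₀ ^ 2 * (μ ^ 2 * η + ν ^ 2 * (1 - η))) / 2 with hq
  set k := max (Real.exp (θ ^ 2 * A ^ 2)) (Real.exp q) with hk
  set k₁ := |θ| * (1 + A * B) + θ ^ 2 * (A ^ 2 * (B + 4)) with hk₁
  set k₂ := 2 * (Real.exp t₀ / ν) ^ 2 * (1 + (A * B) ^ 2) with hk₂
  set k₃ := (|θ| * A) ^ 3 with hk₃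
  have hA0 : 0 < A := Real.exp_pos _
  have hk0 : 0 < k := lt_of_lt_of_le (Real.exp_pos _) (le_max_left _ _)
  have hk20 : 0 ≤ k₂ := by positivity
  have hk30 : 0 ≤ k₃ := by positivity
  -- The first summand serves `T ≤ t₀ + 1`, the second the case `τ = t₀ + 1`. The threshold on `n`
  -- ensures `|θ| A / n ≤ 1/2`, `1 ≤ n` and `2AB ≤ νn`.
  refine ⟨2 * k * (|k₁| * (1 + k₂) + k₃) + 2 * k * (4 / ν ^ 2), by positivity,
    max (2 * (|θ| * A)) (max 1 (2 * A * B / ν)), ?_⟩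
  intro N n hn₀ hn0 hnN C hCN hB T τ x hx hT0 hcase
  have hn1 : 1 ≤ n := (le_max_left _ _).trans ((le_max_right _ _).trans hn₀)
  have hnθ : 2 * (|θ| * A) ≤ n := (le_max_left _ _).trans hn₀
  have hnB : 2 * A * B / ν ≤ n := (le_max_right _ _).trans ((le_max_right _ _).trans hn₀)
  have hB0 : 0 ≤ B := (abs_nonneg _).trans hB
  have hk10 : 0 ≤ k₁ := by positivity
  have hN : (0 : ℝ) < N := by rw [← hnN]; positivity
  have hτ1 : τ ≤ t₀ + 1 := by
    rcases hcase with ⟨_, _, h⟩ | h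
    · exact h
    · exact h.le
  have hM := norm_exponential_le (θ := θ) hν.le hμ hνμ (hx.trans hCN) hn0 hnN
    (Real.exp_pos τ).le (Real.exp_le_exp.2 hτ1)
  have hM' := hM.trans (le_max_left _ (Real.exp q))
  have hE : ‖Complex.exp (-(I * (θ * ν * (n * (T - t₀)) : ℝ)) - I * (θ * n * ν : ℝ) + (q : ℝ))‖
      ≤ k := by
    refine le_trans (le_of_eq ?_) (le_max_right (Real.exp (θ ^ 2 * A ^ 2)) _)
    rw [Complex.norm_exp]
    congr 1
    simp
  rcases hcase with ⟨rfl, rfl, hT⟩ | hτ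
  · set Y := Real.exp T * (x - ν * N) + ν * N with hY
    have hw0 : 0 ≤ Y ^ 2 / n ^ 3 := by positivity
    have hi0 : 0 ≤ 1 / n := by positivity
    obtain ⟨R, hR, hexp⟩ := exists_exponential_eq_exp (θ := θ) hν.le hμ hνμ hCN hn0 hnN
      (Real.exp_pos T).le (Real.exp_le_exp.2 hτ1) (by
        rw [div_le_iff₀ hn0]; linarith)
    rw [hexp] at hM' ⊢
    refine (Complex.norm_exp_sub_exp_le hM' hE).trans ?_
    have h1 := norm_exponent_sub_le (θ := θ) hν.le hμ hνμ hη hην hn1 hnN hB ht₀ hT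
    have h2 := mul_sq_sub_le hν hn1 hnN hB ht₀ ht₀0 hT0 hT
    have h3 : ∀ z w : ℂ, ‖z + R - w‖ ≤ ‖z - w‖ + k₃ / n := fun z w => by
      rw [add_sub_right_comm]
      exact (norm_add_le _ _).trans (by gcongr)
    calc _ ≤ 2 * k * (k₁ * (1 / n + n * (T - t₀) ^ 2) + k₃ / n) := by
          refine mul_le_mul_of_nonneg_left ((h3 _ _).trans ?_) (by positivity)
          gcongr
      _ ≤ 2 * k * (k₁ * ((1 / n + Y ^ 2 / n ^ 3) + k₂ * (1 / n + Y ^ 2 / n ^ 3))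
            + k₃ * (1 / n + Y ^ 2 / n ^ 3)) := by
          rw [div_eq_mul_one_div k₃ n]
          gcongr
          · linarith
          · linarith
      _ ≤ _ := by
          rw [abs_of_nonneg hk10]
          have : 0 ≤ 2 * k * (4 / ν ^ 2) * (1 / n + Y ^ 2 / n ^ 3) := by positivity
          linarith
  · set Y := Real.exp τ * (x - ν * N) + ν * N with hY
    have hw0 : 0 ≤ Y ^ 2 / n ^ 3 := by positivity
    have hi0 : 0 ≤ 1 / n := by positivity
    have hAe : 2 * Real.exp t₀ ≤ A := by
      rw [hA, Real.exp_add, mul_comm]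
      gcongr
      linarith [Real.add_one_le_exp (1 : ℝ)]
    -- At time `t₀ + 1` the factor `e ≥ 2` gives `e^τ (x - νN) ≤ AB - 2νN`, with `AB ≤ νN / 2`.
    -- Hence `Y² / n³ ≥ ν² / 4`, which absorbs the trivial bound `2k`.
    have hYle : Y ≤ -(ν * N / 2) := by
      have h1 : (x : ℝ) ≤ C := by exact_mod_cast hx
      have h2 : (C : ℝ) ≤ η * N + B := by linarith [(abs_le.1 hB).2]
      have h3 : A * (x - ν * N) ≤ A * (B - (ν - η) * N) :=
        mul_le_mul_of_nonneg_left (by linarith) hA0.le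
      have h4 : 2 * ν * N ≤ A * ((ν - η) * N) := by
        have h5 : 0 ≤ (ν - η) * N := mul_nonneg (by linarith) hN.le
        calc 2 * ν * N = 2 * Real.exp t₀ * ((ν - η) * N) := by
              linear_combination (-2 * (N : ℝ)) * ht₀
          _ ≤ A * ((ν - η) * N) := mul_le_mul_of_nonneg_right hAe h5
      have h5 : 2 * A * B ≤ ν * N := by
        rw [div_le_iff₀ hν] at hnB
        rw [← hnN]
        calc 2 * A * B ≤ n * ν := hnB
          _ ≤ n ^ 2 * ν := mul_le_mul_of_nonneg_right (le_self_pow₀ hn1 (by norm_num)) hν.le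
          _ = ν * n ^ 2 := mul_comm _ _
      rw [hY, hτ]
      linarith
    have hYsq : 1 ≤ 4 / ν ^ 2 * (Y ^ 2 / n ^ 3) := by
      have h1 : (ν * N / 2) ^ 2 ≤ Y ^ 2 := by
        rw [← neg_sq Y]
        exact pow_le_pow_left₀ (by positivity) (by linarith) 2
      have h2 : n ^ 3 ≤ (N : ℝ) ^ 2 := by
        rw [← hnN, ← pow_mul]
        exact pow_le_pow_right₀ hn1 (by norm_num)
      rw [div_mul_div_comm, le_div_iff₀ (by positivity)]
      have h3 := mul_le_mul_of_nonneg_left h2 (sq_nonneg ν)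
      have h4 : (ν * N / 2) ^ 2 = ν ^ 2 * (N : ℝ) ^ 2 / 4 := by ring
      linarith
    calc _ ≤ k + k := (norm_sub_le _ _).trans (add_le_add hM' hE)
      _ = 2 * k * 1 := by ring
      _ ≤ 2 * k * (4 / ν ^ 2 * (Y ^ 2 / n ^ 3)) := by gcongr
      _ ≤ _ := by
          have h1 : 0 ≤ 2 * k * (|k₁| * (1 + k₂) + k₃) * (1 / n + Y ^ 2 / n ^ 3) := by positivity
          have h2 : 0 ≤ 2 * k * (4 / ν ^ 2) * (1 / n) := by positivity
          linarith

end Expansion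

/-! ### Characteristic function of the normalised blocking time. -/

section CharFun

open Complex (I)

variable {ν μ η : ℝ}

/-- The characteristic function of the normalised blocking time is within `O(1 / √N)` of that of
the limiting normal law. -/
theorem exists_norm_integral_exp_blockingTime_sub_le (hν : 0 < ν) (hμ : 0 ≤ μ) (hνμ : ν + μ = 1)
    (hη : 0 ≤ η) (hην : η < ν) (θ B : ℝ) {t₀ : ℝ} (ht₀ : Real.exp t₀ * (ν - η) = ν)
    (ht₀0 : 0 ≤ t₀) :
    ∃ K n₀ : ℝ, ∀ (N C : ℕ) (n : ℝ), n₀ ≤ n → 0 < n → n ^ 2 = N → C ≤ N →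
      |(C : ℝ) - η * N| ≤ B → ∀ {Ω : Type*} [MeasurableSpace Ω] (P : Measure Ω)
      [IsProbabilityMeasure P] (X : ℝ≥0 → Ω → Fin (C + 1)), IsEngsetProcess ν μ N C X P →
      (∀ᵐ ω ∂P, X 0 ω = 0) →
      ‖∫ ω, Complex.exp
          (-(I * (θ * ν * (n * ((blockingTime X ω).untopD 0 - t₀)) : ℝ))) ∂P
        - Complex.exp (((θ ^ 2 * ν ^ 2 / 2 - θ ^ 2 * (Real.exp t₀ ^ 2 *
            (μ ^ 2 * η + ν ^ 2 * (1 - η))) / 2 : ℝ) : ℂ))‖ ≤ K / n := by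
  obtain ⟨K, hK0, n₀, hK⟩ := exists_norm_exponential_sub_le hν hμ hνμ hη hην θ B ht₀ ht₀0
  set q := θ ^ 2 * (Real.exp t₀ ^ 2 * (μ ^ 2 * η + ν ^ 2 * (1 - η))) / 2 with hq
  set t₁ : ℝ≥0 := ⟨t₀ + 1, by linarith⟩ with ht₁
  have ht₁c : (t₁ : ℝ) = t₀ + 1 := rfl
  have ht₁0 : 0 < t₁ := by
    rw [← NNReal.coe_pos, ht₁c]
    linarith
  set A2 := Real.exp (2 * t₁) with hA2
  set v := θ ^ 2 * ν ^ 2 / 2 with hv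
  set k := (|θ| * 1) ^ 3 with hk
  have hk0 : 0 ≤ k := by positivity
  refine ⟨Real.exp (-q) * (K * (1 + A2)) + Real.exp (v - q) * (2 * k),
    max n₀ (max (2 * (|θ| * 1)) k), ?_⟩
  intro N C n hn₀ hn0 hnN hCN hB Ω _ P _ X hX hX0
  have hn1 : n₀ ≤ n := (le_max_left _ _).trans hn₀
  have hnθ : 2 * (|θ| * 1) ≤ n := (le_max_left _ _).trans ((le_max_right _ _).trans hn₀)
  have hnk : k ≤ n := (le_max_right _ _).trans ((le_max_right _ _).trans hn₀)
  have hN : (0 : ℝ) < N := by rw [← hnN]; positivity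
  have hfin := hX.ae_blockingTime_ne_top hX0 hν hμ hCN
  set T : Ω → ℝ := fun ω => ((blockingTime X ω).untopD 0 : ℝ≥0) with hT
  have hTm : AEMeasurable T P := hX.aemeasurable_blockingTime hfin
  set τ : Ω → ℝ≥0 := cappedHit X (Fin.last C) t₁ with hτ
  set J : Ω → ℂ := fun ω => Complex.exp (-(I * (θ * ν * (n * (T ω - t₀)) : ℝ))) with hJ
  have hJint : Integrable J P := by
    refine Integrable.of_bound (C := 1) ?_ (Eventually.of_forall fun ω => ?_)
    · refine AEMeasurable.aestronglyMeasurable ?_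
      exact Complex.measurable_exp.comp_aemeasurable
        (((Complex.measurable_ofReal.comp_aemeasurable
          (((hTm.sub_const t₀).const_mul n).const_mul (θ * ν))).const_mul I).neg)
    · rw [hJ, Complex.norm_exp]
      simp
  set z : ℂ := -(I * (θ * n * ν : ℝ)) + (q : ℝ) with hz
  have hsplit : ∀ ω, Complex.exp (-(I * (θ * ν * (n * (T ω - t₀)) : ℝ)) - I * (θ * n * ν : ℝ)
      + (q : ℝ)) = Complex.exp z * J ω := fun ω => by
    rw [hJ, ← Complex.exp_add]
    congr 1
    rw [hz]
    ring
  set M : Ω → ℂ := fun ω => (1 + (I * θ / n : ℂ) * μ * (Real.exp (τ ω) : ℝ)) ^ (X (τ ω) ω : ℕ) *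
    (1 - (I * θ / n : ℂ) * ν * (Real.exp (τ ω) : ℝ)) ^ (N - (X (τ ω) ω : ℕ)) with hM
  have hMint : Integrable M P :=
    IsMarkovJumpProcess.integrable_cappedHit hX
      (F := fun s x => (1 + (I * θ / n : ℂ) * μ * (Real.exp s : ℝ)) ^ (x : ℕ) *
        (1 - (I * θ / n : ℂ) * ν * (Real.exp s : ℝ)) ^ (N - (x : ℕ)))
      (fun _ => by fun_prop) (Fin.last C) ht₁0
  set Y : Ω → ℝ := fun ω => Real.exp (τ ω) * ((X (τ ω) ω : ℕ) - ν * N) + ν * N with hY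
  have hYint : Integrable (fun ω => Y ω ^ 2) P :=
    IsMarkovJumpProcess.integrable_cappedHit hX
      (F := fun s x => (Real.exp s * ((x : ℕ) - ν * N) + ν * N) ^ 2) (fun _ => by fun_prop)
      (Fin.last C) ht₁0
  have hpt : ∀ᵐ ω ∂P, ‖M ω - Complex.exp z * J ω‖ ≤ K * (1 / n + Y ω ^ 2 / n ^ 3) := by
    filter_upwards [hfin, hX.rightContinuous] with ω hω hright
    rw [← hsplit]
    refine hK N n hn1 hn0 hnN C hCN hB (T ω) (τ ω) (X (τ ω) ω)
      (Nat.lt_succ_iff.1 (X (τ ω) ω).2) (NNReal.coe_nonneg _) ?_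
    obtain ⟨u, hu⟩ := WithTop.ne_top_iff_exists.1 hω
    have hTu : T ω = u := by rw [hT]; simp only [← hu, WithTop.untopD_coe]
    rcases le_total u t₁ with hle | hle
    · left
      have hτu : τ ω = u := cappedHit_of_lt hu.symm hle
      rw [hτu, apply_eq_of_hittingAfter_eq hright hu.symm]
      exact ⟨hTu, rfl, hle⟩
    · right
      have hτt : τ ω = t₁ := cappedHit_of_le (by
        change _ ≤ blockingTime X ω
        rw [← hu]
        exact WithTop.coe_le_coe.2 hle)
      rw [hτt, ht₁c]
  have herr : ‖∫ ω, M ω ∂P - Complex.exp z * ∫ ω, J ω ∂P‖ ≤ K * (1 + A2) / n := by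
    rw [← integral_const_mul, ← integral_sub hMint (hJint.const_mul _)]
    have hg : Integrable (fun ω => K * (1 / n + Y ω ^ 2 / n ^ 3)) P :=
      ((integrable_const _).add (hYint.div_const _)).const_mul _
    refine (norm_integral_le_of_norm_le hg hpt).trans ?_
    rw [integral_const_mul, integral_add (integrable_const _) (hYint.div_const _),
      integral_div (n ^ 3) fun ω => Y ω ^ 2, integral_const, probReal_univ, one_smul, mul_div_assoc]
    refine mul_le_mul_of_nonneg_left ?_ hK0
    have h1 := hX.integral_sq_cappedHit_le hX0 hνμ hν hμ hCN ht₁0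
    calc 1 / n + (∫ ω, Y ω ^ 2 ∂P) / n ^ 3 ≤ 1 / n + A2 * N / n ^ 3 := by gcongr
      _ = (1 + A2) / n := by
          rw [← hnN]
          field_simp
  have hMean : ∫ ω, M ω ∂P = (1 - (I * θ / n : ℂ) * ν) ^ N :=
    hX.integral_exponential_cappedHit hX0 hνμ hCN _ ht₁0
  -- The same expansion at the initial point `s = 0`, `x = 0` evaluates the mean. Its phase equals
  -- that in `z` and cancels on division by `exp z`, leaving `v - q`.
  obtain ⟨R, hR, hexp⟩ := exists_exponential_eq_exp (θ := θ) (x := 0) (a := 1) hν.le hμ hνμ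
    (Nat.zero_le N) hn0 hnN zero_le_one le_rfl (by rw [div_le_iff₀ hn0]; linarith)
  have hMean' : ∫ ω, M ω ∂P = Complex.exp (z + (v - q : ℝ) + R) := by
    rw [hMean]
    simp only [pow_zero, one_mul, Complex.ofReal_one, mul_one, Nat.sub_zero] at hexp
    rw [hexp]
    congr 2
    have h1 : θ * ((((0 : ℕ) : ℝ) - ν * N) / n) = -(θ * n * ν) := by
      rw [← hnN]; field_simp; simp; ring
    have h2 : θ ^ 2 * (1 ^ 2 * (μ ^ 2 * ((0 : ℕ) : ℝ) + ν ^ 2 * (N - ((0 : ℕ) : ℝ))) / N) / 2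
        = v := by
      rw [hv]; field_simp; simp; ring
    rw [h1, h2, hz]
    push_cast
    ring
  have hR1 : ‖R‖ ≤ 1 := hR.trans ((div_le_one hn0).2 hnk)
  have hfinal : ∫ ω, J ω ∂P - Complex.exp ((v - q : ℝ) : ℂ)
      = -(Complex.exp (-z) * (∫ ω, M ω ∂P - Complex.exp z * ∫ ω, J ω ∂P))
        + Complex.exp ((v - q : ℝ) : ℂ) * (Complex.exp R - 1) := by
    have h1 : Complex.exp (-z) * Complex.exp z = 1 := by rw [← Complex.exp_add]; simp
    rw [hMean', Complex.exp_add, Complex.exp_add]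
    linear_combination (Complex.exp ((v - q : ℝ) : ℂ) * Complex.exp R - ∫ ω, J ω ∂P) * h1
  rw [hfinal]
  refine (norm_add_le _ _).trans ?_
  rw [norm_neg, norm_mul, norm_mul]
  have hz1 : ‖Complex.exp (-z)‖ = Real.exp (-q) := by
    rw [Complex.norm_exp, hz]
    congr 1
    simp
  have hz2 : ‖Complex.exp ((v - q : ℝ) : ℂ)‖ = Real.exp (v - q) := by
    rw [Complex.norm_exp, Complex.ofReal_re]
  rw [hz1, hz2]
  calc _ ≤ Real.exp (-q) * (K * (1 + A2) / n) + Real.exp (v - q) * (2 * (k / n)) := by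
        gcongr
        exact (Complex.norm_exp_sub_one_le hR1).trans (by gcongr)
    _ = _ := by ring

end CharFun

/-! ### Convergence in distribution. -/

theorem mainTheorem3 (ν μ η : ℝ) (hμ : 0 ≤ μ) (hνμ : ν + μ = 1) (hη : 0 < η) (hην : η < ν)
    (C : ℕ → ℕ) (hC : ∀ N, 1 ≤ N → 1 ≤ C N ∧ C N ≤ N)
    (hCη : (fun N : ℕ => (C N : ℝ) - η * (N : ℝ)) =O[atTop] (fun _ : ℕ => (1 : ℝ)))
    {Ω : ℕ → Type*} [∀ N, MeasurableSpace (Ω N)]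
    (P : (N : ℕ) → Measure (Ω N)) [∀ N, IsProbabilityMeasure (P N)]
    (X : (N : ℕ) → ℝ≥0 → Ω N → Fin (C N + 1))
    (hX : ∀ N, 1 ≤ N → IsEngsetProcess ν μ N (C N) (X N) (P N))
    (hX0 : ∀ N, 1 ≤ N → ∀ᵐ ω ∂(P N), X N 0 ω = 0) :
    (∀ N, 1 ≤ N → ∀ᵐ ω ∂(P N), blockingTime (X N) ω ≠ ⊤) ∧
    TendstoInDistribution
      (fun (N : ℕ) (ω : Ω N) =>
        √(N : ℝ) * (((blockingTime (X N) ω).untopD 0 : ℝ≥0) - Real.log (ν / (ν - η))))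
      atTop (id : ℝ → ℝ) P
      (gaussianReal 0 (Real.toNNReal (η * (1 - η) / (ν - η) ^ 2))) := by
  have hν : 0 < ν := hη.trans hην
  have hd : 0 < ν - η := by linarith
  have hfin : ∀ N, 1 ≤ N → ∀ᵐ ω ∂(P N), blockingTime (X N) ω ≠ ⊤ := fun N hN =>
    (hX N hN).ae_blockingTime_ne_top (hX0 N hN) hν hμ (hC N hN).2
  set t₀ := Real.log (ν / (ν - η)) with ht₀def
  have hexp : Real.exp t₀ = ν / (ν - η) := Real.exp_log (by positivity)
  have ht₀ : Real.exp t₀ * (ν - η) = ν := by rw [hexp]; field_simp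
  have ht₀0 : 0 ≤ t₀ := Real.log_nonneg ((one_le_div hd).2 (by linarith))
  have hmeas : ∀ N : ℕ, AEMeasurable (fun ω =>
      √(N : ℝ) * (((blockingTime (X N) ω).untopD 0 : ℝ≥0) - t₀)) (P N) := by
    intro N
    -- Nothing is assumed of the process at `N = 0`, but there the factor `√N` makes the variable
    -- zero.
    rcases Nat.eq_zero_or_pos N with rfl | hN
    · simp
    · exact (((hX N hN).aemeasurable_blockingTime (hfin N hN)).sub_const _).const_mul _
  refine ⟨hfin, hmeas, by fun_prop, ?_⟩
  refine ProbabilityMeasure.tendsto_iff_tendsto_charFun.2 fun s => ?_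
  obtain ⟨B, hB⟩ := hCη.bound
  -- The choice `θ = -s/ν` turns the phase `-iθν√N (T - t₀)` into `i s √N (T - t₀)`.
  obtain ⟨K, n₀, hK⟩ := exists_norm_integral_exp_blockingTime_sub_le hν hμ hνμ hη.le hην
    (-s / ν) B ht₀ ht₀0
  have hsqrt : Tendsto (fun N : ℕ => √(N : ℝ)) atTop atTop :=
    Real.tendsto_sqrt_atTop.comp tendsto_natCast_atTop_atTop
  refine tendsto_iff_norm_sub_tendsto_zero.2 (squeeze_zero' (Eventually.of_forall fun N =>
    norm_nonneg _) ?_ ((tendsto_const_nhds (x := K)).div_atTop hsqrt))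
  filter_upwards [hB, hsqrt.eventually_ge_atTop n₀, eventually_ge_atTop 1] with N hBN hn₀ hN
  have hN0 : (0 : ℝ) < N := by exact_mod_cast hN
  have h := hK N (C N) (√(N : ℝ)) hn₀ (Real.sqrt_pos.2 hN0) (Real.sq_sqrt hN0.le) (hC N hN).2
    (by simpa using hBN) (P N) (X N) (hX N hN) (hX0 N hN)
  refine le_trans (le_of_eq ?_) h
  congr 2
  · simp only [ProbabilityMeasure.coe_mk]
    rw [charFun_apply_real, integral_map (hmeas N) (by fun_prop)]
    refine integral_congr_ae (Eventually.of_forall fun ω => ?_)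
    have hνc : (ν : ℂ) ≠ 0 := by exact_mod_cast hν.ne'
    simp only
    congr 1
    push_cast
    field_simp
  · simp only [ProbabilityMeasure.coe_mk, Measure.map_id]
    rw [charFun_gaussianReal]
    have hσ : 0 ≤ η * (1 - η) / (ν - η) ^ 2 := by
      have : 0 ≤ 1 - η := by linarith
      positivity
    rw [Real.coe_toNNReal _ hσ]
    have heq : (-s / ν) ^ 2 * ν ^ 2 / 2 - (-s / ν) ^ 2 * (Real.exp t₀ ^ 2 *
        (μ ^ 2 * η + ν ^ 2 * (1 - η))) / 2 = -(η * (1 - η) / (ν - η) ^ 2 * s ^ 2 / 2) := by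
      rw [hexp]
      obtain rfl : μ = 1 - ν := by linarith
      field_simp
      ring
    rw [heq]
    congr 1
    push_cast
    ring
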